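/- Theorem 4.5 (Online Learning of Smooth MWIS). An MWIS instance $x$ on $n$ vertices is an undirected graph on $[n]$ with vertex weights $w_v$. For $\rho\in[0,1]$ let $A_\rho$ be the greedy heuristic that, starting with all vertices unblocked, repeatedly adds to its solution an unblocked vertex $v$ maximizing $w_v/(1+\deg v)^{\rho}$ (ties broken by smallest index) and blocks $v$ and its neighbours. Here $\deg v$ is the degree in the whole graph (non-adaptive version) or in the subgraph induced by the currently unblocked vertices (adaptive version). Let $\mathrm{cost}(A_\rho,x)$ be the total weight of the returned independent set (to be maximized). Let $0<\sigma<1$. A sequence $x_1,x_2,\dots$ of instances is $\sigma$-smooth if the graphs on $[n]$ are arbitrary and the weights $w_{t,v}$ are independent, each drawn from an arbitrary distribution $\Delta_{t,v}$ with support in $[0,1]$ and density at most $1/\sigma$; the graphs and distributions are fixed in advance and unknown to the learner. In round $t$ an online learning algorithm, which knows $n$ and $\sigma$, chooses $\rho_t\in[0,1]$ knowing only $x_1,\dots,x_{t-1}$ and its own random draws (which are independent of the weights), and then sees $x_t$. Its regret after $T$ rounds is $$R_T=\frac1T\Big(\sup_{\rho\in[0,1]}\sum_{t=1}^T \mathrm{cost}(A_\rho,x_t)-\sum_{t=1}^T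 \mathrm{cost}(A_{\rho_t},x_t)\Big).$$ For each of the two versions of the heuristic and every $d\in\mathbb N$ there are an online learning algorithm (one program for a randomized real RAM, that is, a machine with exact unit-cost arithmetic and comparisons of reals and unit-cost uniform random draws from $[0,1]$) and a constant $C$ such that for all $n\ge1$ and $\sigma\in(0,1)$: 1. on all instance sequences with weights in $[0,1]$ and for all outcomes of the draws, the initialization and every round take at most $C(n+1/\sigma)^C$ steps each; 2. for every $\sigma$-smooth sequence and every $T\ge C(n+1/\sigma)^C$, the expected regret (over the weights and the random draws) satisfies $\mathbb E[R_T]\le n^{-d}$. -/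

import Mathlib

open MeasureTheory Set
open scoped ENNReal

noncomputable section

/-! The greedy heuristics for maximum-weight independent set (MWIS). -/

/-- An MWIS instance on the vertex set `Fin n`: an undirected graph with vertex weights. -/
structure MWISInstance (n : ℕ) where
  graph : SimpleGraph (Fin n)
  weight : Fin n → ℝ

/-- Whether `deg v` is taken in the original graph (`nonadaptive`), or in the subgraph induced by
the vertices that are not yet blocked from consideration (`adaptive`). -/
inductive GreedyVariant where
  | nonadaptive
  | adaptive

namespace MWISInstance

variable {n : ℕ}

open Classical in
/-- The degree of `v` that the heuristic uses when `S` is the set of vertices still under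
consideration. -/
def deg (V : GreedyVariant) (x : MWISInstance n) (S : Finset (Fin n)) (v : Fin n) : ℕ :=
  match V with
  | .nonadaptive => (Finset.univ.filter fun u => x.graph.Adj v u).card
  | .adaptive => (S.filter fun u => x.graph.Adj v u).card

/-- The score `w_v / (1 + deg v) ^ ρ`. -/
def score (V : GreedyVariant) (ρ : ℝ) (x : MWISInstance n) (S : Finset (Fin n)) (v : Fin n) : ℝ :=
  x.weight v / (1 + (x.deg V S v : ℝ)) ^ ρ

open Classical in
/-- The vertices of `S` of largest score. -/
def best (V : GreedyVariant) (ρ : ℝ) (x : MWISInstance n) (S : Finset (Fin n)) :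
    Finset (Fin n) :=
  S.filter fun v => ∀ u ∈ S, x.score V ρ S u ≤ x.score V ρ S v

open Classical in
/-- At most `k` rounds of the greedy heuristic on the set `S` of unblocked vertices: take a vertex
of largest score (of several, the one of smallest index), block it and its neighbours, continue. -/
def greedy (V : GreedyVariant) (ρ : ℝ) (x : MWISInstance n) :
    ℕ → Finset (Fin n) → Finset (Fin n)
  | 0, _ => ∅
  | k + 1, S =>
    if h : (x.best V ρ S).Nonempty then
      let v := (x.best V ρ S).min' h
      insert v (greedy V ρ x k (S.filter fun u => u ≠ v ∧ ¬ x.graph.Adj v u))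
    else ∅

/-- The independent set returned by the heuristic `A_ρ`. Every round blocks at least one vertex, so
after `n` rounds none is left. -/
def output (V : GreedyVariant) (ρ : ℝ) (x : MWISInstance n) : Finset (Fin n) :=
  x.greedy V ρ n Finset.univ

/-- The performance (to be maximized) of `A_ρ` on `x`: the total weight of the returned set. -/
def cost (V : GreedyVariant) (ρ : ℝ) (x : MWISInstance n) : ℝ :=
  ∑ v ∈ x.output V ρ, x.weight v

end MWISInstance

/-- The regret after `T` rounds of the choices `ρ 0, ρ 1, …` on the instances `x 0, x 1, …`, against
the best fixed parameter in `[0, 1]`. -/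
def regret {n : ℕ} (V : GreedyVariant) (x : ℕ → MWISInstance n) (ρ : ℕ → ℝ) (T : ℕ) : ℝ :=
  (1 / (T : ℝ)) * ((⨆ r : Icc (0 : ℝ) 1, ∑ t ∈ Finset.range T, (x t).cost V r)
    - ∑ t ∈ Finset.range T, (x t).cost V (ρ t))

/-- `μ` has a density that is pointwise at most `1 / σ` and vanishes outside `[0, 1]`. -/
def IsSmooth (σ : ℝ) (μ : Measure ℝ) : Prop :=
  ∃ f : ℝ → ℝ≥0∞, Measurable f ∧ (∀ y, f y ≤ ENNReal.ofReal (1 / σ)) ∧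
    (∀ y, y ∉ Icc (0 : ℝ) 1 → f y = 0) ∧ μ = volume.withDensity f

/-! A randomized real RAM, programmed in a structured language. There are integer and real
registers, arranged in arrays. Real arithmetic is exact, and there is neither a rounding operation
nor any transcendental function; integers can only be added and subtracted. -/

namespace RealRAM

/-- Read-only input: the parameters `n` and `σ`, an adjacency matrix and a vector of weights. -/
structure Input where
  size : ℕ
  sigma : ℝ
  adj : ℕ → ℕ → ℕ
  weight : ℕ → ℝ

/-- The memory, with the number of random draws made and the number of steps taken so far. -/
structure Mem where
  nat : ℕ → ℕ → ℕ
  real : ℕ → ℕ → ℝ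
  draws : ℕ
  time : ℕ

/-- Integer expressions; `load a i` is the entry of index `i` of the integer array `a`, and `sub` is
truncated at `0`. -/
inductive NExp where
  | const (k : ℕ)
  | size
  | adj (i j : NExp)
  | load (a : ℕ) (i : NExp)
  | add (e f : NExp)
  | sub (e f : NExp)

/-- Real expressions; `load a i` is the entry of index `i` of the real array `a`. -/
inductive RExp where
  | const (q : ℚ)
  | cast (e : NExp)
  | sigma
  | weight (i : NExp)
  | load (a : ℕ) (i : NExp)
  | add (e f : RExp)
  | sub (e f : RExp)
  | mul (e f : RExp)
  | div (e f : RExp)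

/-- Programs. `setN a i e` and `setR a i e` store the value of `e` at index `i` of array `a`;
`draw a i` stores there a fresh uniform random number from `[0, 1]`; `ite e f c c'` runs `c` if
`e < f` and `c'` otherwise; `loop a e c` is the loop `for k = 0, 1, 2, … while k < e do c`, with `e`
evaluated once at the beginning and `k` stored at index `0` of the integer array `a`. -/
inductive Cmd where
  | skip
  | setN (a : ℕ) (i : NExp) (e : NExp)
  | setR (a : ℕ) (i : NExp) (e : RExp)
  | draw (a : ℕ) (i : NExp)
  | seq (c c' : Cmd)
  | ite (e f : RExp) (c c' : Cmd)
  | loop (a : ℕ) (e : RExp) (c : Cmd)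

def NExp.eval (I : Input) (m : Mem) : NExp → ℕ
  | .const k => k
  | .size => I.size
  | .adj i j => I.adj (i.eval I m) (j.eval I m)
  | .load a i => m.nat a (i.eval I m)
  | .add e f => e.eval I m + f.eval I m
  | .sub e f => e.eval I m - f.eval I m

/-- The number of steps that an evaluation takes: one for every operation. -/
def NExp.steps : NExp → ℕ
  | .const _ => 1
  | .size => 1
  | .adj i j => i.steps + j.steps + 1
  | .load _ i => i.steps + 1
  | .add e f => e.steps + f.steps + 1
  | .sub e f => e.steps + f.steps + 1

def RExp.eval (I : Input) (m : Mem) : RExp → ℝ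
  | .const q => q
  | .cast e => e.eval I m
  | .sigma => I.sigma
  | .weight i => I.weight (i.eval I m)
  | .load a i => m.real a (i.eval I m)
  | .add e f => e.eval I m + f.eval I m
  | .sub e f => e.eval I m - f.eval I m
  | .mul e f => e.eval I m * f.eval I m
  | .div e f => e.eval I m / f.eval I m

/-- The number of steps that an evaluation takes: one for every operation. -/
def RExp.steps : RExp → ℕ
  | .const _ => 1
  | .cast e => e.steps + 1
  | .sigma => 1
  | .weight i => i.steps + 1
  | .load _ i => i.steps + 1
  | .add e f => e.steps + f.steps + 1
  | .sub e f => e.steps + f.steps + 1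
  | .mul e f => e.steps + f.steps + 1
  | .div e f => e.steps + f.steps + 1

def Mem.storeN (m : Mem) (a i k : ℕ) : Mem :=
  { m with nat := Function.update m.nat a (Function.update (m.nat a) i k) }

def Mem.storeR (m : Mem) (a i : ℕ) (r : ℝ) : Mem :=
  { m with real := Function.update m.real a (Function.update (m.real a) i r) }

def Mem.tick (m : Mem) (k : ℕ) : Mem :=
  { m with time := m.time + k }

/-- The memory after a program has been run, where `U k` is the result of the `k`-th draw. A loop
with bound `y` makes `⌈y⌉₊` iterations, as `k < ⌈y⌉₊` holds exactly when `(k : ℝ) < y`; each costs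
one step more than its body, and one step pays for the last, failing test. -/
def Cmd.run (U : ℕ → unitInterval) (I : Input) : Cmd → Mem → Mem
  | .skip, m => m.tick 1
  | .setN a i e, m => (m.storeN a (i.eval I m) (e.eval I m)).tick (i.steps + e.steps + 1)
  | .setR a i e, m => (m.storeR a (i.eval I m) (e.eval I m)).tick (i.steps + e.steps + 1)
  | .draw a i, m =>
    { (m.storeR a (i.eval I m) (U m.draws)).tick (i.steps + 1) with draws := m.draws + 1 }
  | .seq c c', m => c'.run U I (c.run U I m)
  | .ite e f c c', m =>
    open Classical in
    if e.eval I m < f.eval I m then c.run U I (m.tick (e.steps + f.steps + 1))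
    else c'.run U I (m.tick (e.steps + f.steps + 1))
  | .loop a e c, m =>
    Nat.rec (motive := fun _ => Mem) (m.tick (e.steps + 1))
      (fun k m' => c.run U I ((m'.storeN a 0 k).tick 1)) ⌈e.eval I m⌉₊

end RealRAM

open RealRAM

/-! Online learning of the parameter `ρ` by a program. -/

/-- An online learning algorithm: `start` is run once; in every round, `choose` is run before the
instance of that round is revealed, and `update` after that. -/
structure Learner where
  start : Cmd
  choose : Cmd
  update : Cmd

/-- The input when no instance is shown: only the parameters `n` and `σ`. -/
def paramInput (n : ℕ) (σ : ℝ) : Input where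
  size := n
  sigma := σ
  adj := fun _ _ => 0
  weight := fun _ => 0

open Classical in
/-- The input that shows the instance `x`. -/
def instanceInput {n : ℕ} (σ : ℝ) (x : MWISInstance n) : Input where
  size := n
  sigma := σ
  adj := fun i j => if ∃ (hi : i < n) (hj : j < n), x.graph.Adj ⟨i, hi⟩ ⟨j, hj⟩ then 1 else 0
  weight := fun i => if hi : i < n then x.weight ⟨i, hi⟩ else 0

namespace Learner

variable {n : ℕ}

/-- The memory before round `t`. It depends on `x 0, …, x (t - 1)` only. -/
def memory (L : Learner) (σ : ℝ) (U : ℕ → unitInterval) (x : ℕ → MWISInstance n) : ℕ → Mem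
  | 0 => L.start.run U (paramInput n σ) ⟨fun _ _ => 0, fun _ _ => 0, 0, 0⟩
  | t + 1 => L.update.run U (instanceInput σ (x t))
      (L.choose.run U (paramInput n σ) (L.memory σ U x t))

/-- The parameter chosen for round `t`: the entry `0` of the real array `0` after `choose`. -/
def action (L : Learner) (σ : ℝ) (U : ℕ → unitInterval) (x : ℕ → MWISInstance n) (t : ℕ) : ℝ :=
  (L.choose.run U (paramInput n σ) (L.memory σ U x t)).real 0 0

end Learner

/-- The law of all vertex weights (indexed by round and vertex) and all random draws of the learner:
everything is independent, the weight of vertex `v` in round `t` has law `Δ t v`, and every draw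
is uniform on `[0, 1]`. -/
def smoothLaw {n : ℕ} (Δ : ℕ → Fin n → ProbabilityMeasure ℝ) :
    Measure ((ℕ → Fin n → ℝ) × (ℕ → unitInterval)) :=
  (Measure.infinitePi fun t => Measure.pi fun v => (Δ t v : Measure ℝ)).prod
    (Measure.infinitePi fun _ => (volume : Measure unitInterval))

/-- The sequence of instances with graphs `G t` and weights `w t`. -/
def instances {n : ℕ} (G : ℕ → SimpleGraph (Fin n)) (w : ℕ → Fin n → ℝ) (t : ℕ) :
    MWISInstance n :=
  ⟨G t, w t⟩

end

/-!
The learner runs multiplicative weights over the grid `i / N`, with `N` a power of `n + 1 / σ`, so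
its expected cost competes with that of the best grid point. A program without real powers can
simulate the greedy run at `i / N` exactly, because `(w / (1 + deg) ^ (i / N)) ^ N` is
`w ^ N / (1 + deg) ^ i`.

It remains to compare an arbitrary `ρ` in a cell `[i / N, (i + 1) / N]` with the grid point
`i / N`. The two greedy runs coincide unless the ratio of two weights lies in one of at most `n ^ 4`
intervals of length at most `n ^ 2 / N`; smoothness bounds the probability of this event by
`n ^ 6 / (N * σ)`. The rounds being independent, the number of bad rounds of a cell has variance at
most `T * n ^ 6 / (N * σ)`. These variances sum to at most `T * n ^ 6 / σ` over the cells, so a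
second-moment argument bounds the deviations of all `N` counts at once, and hence the loss uniformly
in `ρ`.
-/

open RealRAM ProbabilityTheory

noncomputable section

namespace RealRAM

variable {U : ℕ → unitInterval} {I : Input}

@[simp] theorem Mem.storeN_nat (m : Mem) (a i k : ℕ) :
    (m.storeN a i k).nat = Function.update m.nat a (Function.update (m.nat a) i k) := rfl
@[simp] theorem Mem.storeN_real (m : Mem) (a i k : ℕ) : (m.storeN a i k).real = m.real := rfl
@[simp] theorem Mem.storeN_time (m : Mem) (a i k : ℕ) : (m.storeN a i k).time = m.time := rfl
@[simp] theorem Mem.storeR_nat (m : Mem) (a i : ℕ) (r : ℝ) : (m.storeR a i r).nat = m.nat := rfl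
@[simp] theorem Mem.storeR_real (m : Mem) (a i : ℕ) (r : ℝ) :
    (m.storeR a i r).real = Function.update m.real a (Function.update (m.real a) i r) := rfl
@[simp] theorem Mem.storeR_time (m : Mem) (a i : ℕ) (r : ℝ) :
    (m.storeR a i r).time = m.time := rfl
@[simp] theorem Mem.tick_nat (m : Mem) (k : ℕ) : (m.tick k).nat = m.nat := rfl
@[simp] theorem Mem.tick_real (m : Mem) (k : ℕ) : (m.tick k).real = m.real := rfl
@[simp] theorem Mem.tick_time (m : Mem) (k : ℕ) : (m.tick k).time = m.time + k := rfl

theorem Cmd.run_loop_induction {a : ℕ} {e : RExp} {c : Cmd} {m : Mem} (P : ℕ → Mem → Prop)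
    (zero : P 0 (m.tick (e.steps + 1)))
    (succ : ∀ k m', k < ⌈e.eval I m⌉₊ → P k m' →
      P (k + 1) (c.run U I ((m'.storeN a 0 k).tick 1))) :
    P ⌈e.eval I m⌉₊ ((Cmd.loop a e c).run U I m) := by
  have invariant : ∀ j ≤ ⌈e.eval I m⌉₊,
      P j (Nat.rec (motive := fun _ => Mem) (m.tick (e.steps + 1))
        (fun k m' => c.run U I ((m'.storeN a 0 k).tick 1)) j) := by
    intro j hj
    induction j with
    | zero => exact zero
    | succ j ih => exact succ j _ (by omega) (ih (by omega))
  exact invariant _ le_rfl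

/-- A part of the memory of which a program may be seen, from its text alone, to leave it alone:
an integer array, a real array, or the count of the random draws. -/
inductive Component where
  | nat (a : ℕ)
  | real (a : ℕ)
  | draws

/-- The memories `m` and `m'` agree on a component. -/
def Component.Agree (m m' : Mem) : Component → Prop
  | .nat a => m.nat a = m'.nat a
  | .real a => m.real a = m'.real a
  | .draws => m.draws = m'.draws

theorem Component.Agree.trans {x : Component} {m₁ m₂ m₃ : Mem} (h : x.Agree m₁ m₂)
    (h' : x.Agree m₂ m₃) : x.Agree m₁ m₃ := by
  cases x <;> exact Eq.trans h h'

theorem Component.agree_tick (x : Component) (m : Mem) (k : ℕ) : x.Agree (m.tick k) m := by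
  cases x <;> rfl

/-- Whether a program has an instruction that may change a component. It is Boolean so that `rfl`
decides it for a concrete program. -/
def Cmd.writes : Component → Cmd → Bool
  | _, .skip => false
  | .nat a, .setN b _ _ => b == a
  | .real a, .setR b _ _ => b == a
  | .real a, .draw b _ => b == a
  | .draws, .draw _ _ => true
  | _, .setN _ _ _ | _, .setR _ _ _ | _, .draw _ _ => false
  | x, .seq c c' => c.writes x || c'.writes x
  | x, .ite _ _ c c' => c.writes x || c'.writes x
  | .nat a, .loop b _ c => b == a || c.writes (.nat a)
  | x, .loop _ _ c => c.writes x

theorem Component.agree_storeN {x : Component} {a : ℕ} {i e : NExp}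
    (h : (Cmd.setN a i e).writes x = false) (m : Mem) (j k : ℕ) :
    x.Agree (m.storeN a j k) m := by
  cases x with
  | nat b => exact Function.update_of_ne (Ne.symm (by simpa [Cmd.writes] using h)) _ _
  | real _ | draws => rfl

theorem Component.agree_storeR {x : Component} {a : ℕ} {i : NExp} {e : RExp}
    (h : (Cmd.setR a i e).writes x = false) (m : Mem) (j : ℕ) (r : ℝ) :
    x.Agree (m.storeR a j r) m := by
  cases x with
  | real b => exact Function.update_of_ne (Ne.symm (by simpa [Cmd.writes] using h)) _ _
  | nat _ | draws => rfl

theorem Cmd.run_agree {x : Component} {c : Cmd} (h : c.writes x = false) (m : Mem) :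
    x.Agree (c.run U I m) m := by
  induction c generalizing m with
  | skip => exact x.agree_tick m 1
  | setN b i e => exact (x.agree_tick _ _).trans (Component.agree_storeN h _ _ _)
  | setR b i e => exact (x.agree_tick _ _).trans (Component.agree_storeR h _ _ _)
  | draw b i =>
    cases x with
    | nat a => rfl
    | real a => exact Component.agree_storeR (x := .real a) (i := i) (e := .sigma) h _ _ _
    | draws => exact absurd h (by simp [writes])
  | seq c c' ih ih' =>
    obtain ⟨h, h'⟩ : c.writes x = false ∧ c'.writes x = false := by simpa [writes] using h
    exact (ih' h' _).trans (ih h m)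
  | ite e f c c' ih ih' =>
    obtain ⟨h, h'⟩ : c.writes x = false ∧ c'.writes x = false := by simpa [writes] using h
    rw [Cmd.run]
    split_ifs
    · exact (ih h _).trans (x.agree_tick m _)
    · exact (ih' h' _).trans (x.agree_tick m _)
  | loop b e c ih =>
    obtain ⟨hb, hc⟩ :
        (Cmd.setN b (.const 0) (.const 0)).writes x = false ∧ c.writes x = false := by
      cases x <;> simpa [writes] using h
    exact Cmd.run_loop_induction (fun _ m' => x.Agree m' m) (x.agree_tick m _) fun k m' _ hm' =>
      (ih hc _).trans ((x.agree_tick _ _).trans ((Component.agree_storeN hb _ _ _).trans hm'))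

theorem Cmd.run_nat {a : ℕ} {c : Cmd} (h : c.writes (.nat a) = false) (m : Mem) :
    (c.run U I m).nat a = m.nat a :=
  Cmd.run_agree h m

theorem Cmd.run_real {a : ℕ} {c : Cmd} (h : c.writes (.real a) = false) (m : Mem) :
    (c.run U I m).real a = m.real a :=
  Cmd.run_agree h m

theorem Cmd.run_draws {c : Cmd} (h : c.writes .draws = false) (m : Mem) :
    (c.run U I m).draws = m.draws :=
  Cmd.run_agree h m

open Polynomial in
/-- A bound for the running time of a program, as a polynomial in a bound for the number of
iterations of each of its loops. -/
def Cmd.timeBound : Cmd → ℕ[X]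
  | .skip => 1
  | .setN _ i e => C (i.steps + e.steps + 1)
  | .setR _ i e => C (i.steps + e.steps + 1)
  | .draw _ i => C (i.steps + 1)
  | .seq c c' => c.timeBound + c'.timeBound
  | .ite e f c c' => C (e.steps + f.steps + 1) + (c.timeBound + c'.timeBound)
  | .loop _ e c => C (e.steps + 1) + X * (1 + c.timeBound)

/-- No loop makes more than `B` iterations as long as `N` is stored at index `0` of the integer
array `0`. -/
def Cmd.LoopsBounded (I : Input) (N B : ℕ) : Cmd → Prop
  | .seq c c' => c.LoopsBounded I N B ∧ c'.LoopsBounded I N B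
  | .ite _ _ c c' => c.LoopsBounded I N B ∧ c'.LoopsBounded I N B
  | .loop _ e c => (∀ m : Mem, m.nat 0 0 = N → ⌈e.eval I m⌉₊ ≤ B) ∧ c.LoopsBounded I N B
  | _ => True

theorem Cmd.run_loop_time_le {b : ℕ} {e : RExp} {c : Cmd} {N τ : ℕ} (m : Mem) (hb : b ≠ 0)
    (hm : m.nat 0 0 = N) (hc : c.writes (.nat 0) = false)
    (hτ : ∀ m' : Mem, m'.nat 0 0 = N → (c.run U I m').time ≤ m'.time + τ) :
    ((Cmd.loop b e c).run U I m).time ≤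
      m.time + (e.steps + 1 + ⌈e.eval I m⌉₊ * (1 + τ)) := by
  refine (Cmd.run_loop_induction (fun k m' => m'.nat 0 0 = N ∧
    m'.time ≤ m.time + (e.steps + 1 + k * (1 + τ))) ⟨hm, by simp⟩ ?_).2
  rintro k m' - ⟨hN, htime⟩
  have hN' : ((m'.storeN b 0 k).tick 1).nat 0 0 = N := by
    simp [Function.update_of_ne hb.symm, hN]
  have hbody := hτ _ hN'
  simp only [Mem.tick_time, Mem.storeN_time] at hbody
  exact ⟨by rw [Cmd.run_nat hc, hN'], by rw [Nat.succ_mul]; omega⟩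

theorem Cmd.run_time_le {c : Cmd} {N B : ℕ} (hw : c.writes (.nat 0) = false)
    (hc : c.LoopsBounded I N B) (m : Mem) (hm : m.nat 0 0 = N) :
    (c.run U I m).time ≤ m.time + c.timeBound.eval B := by
  induction c generalizing m with
  | skip | setN _ _ _ | setR _ _ _ | draw _ _ => simp [Cmd.run, timeBound]
  | seq c c' ih ih' =>
    simp only [writes, Bool.or_eq_false_iff] at hw
    have h := ih hw.1 hc.1 m hm
    have h' := ih' hw.2 hc.2 (c.run U I m) (by rw [Cmd.run_nat hw.1, hm])
    simp only [Cmd.run, timeBound, Polynomial.eval_add]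
    omega
  | ite e f c c' ih ih' =>
    simp only [writes, Bool.or_eq_false_iff] at hw
    have h := ih hw.1 hc.1 (m.tick (e.steps + f.steps + 1)) hm
    have h' := ih' hw.2 hc.2 (m.tick (e.steps + f.steps + 1)) hm
    simp only [Mem.tick_time] at h h'
    simp only [Cmd.run, timeBound, Polynomial.eval_add, Polynomial.eval_C]
    split_ifs <;> omega
  | loop b e c ih =>
    simp only [writes, Bool.or_eq_false_iff, beq_eq_false_iff_ne, ne_eq] at hw
    refine (Cmd.run_loop_time_le m hw.1 hm hw.2 (ih hw.2 hc.2)).trans ?_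
    simp only [timeBound, Polynomial.eval_add, Polynomial.eval_mul, Polynomial.eval_C,
      Polynomial.eval_X, Polynomial.eval_one]
    gcongr
    exact hc.1 m hm

/-- The integer register at index `0` of the integer array `a`. -/
def NExp.reg (a : ℕ) : NExp := .load a (.const 0)

/-- The real register at index `0` of the real array `a`. -/
def RExp.reg (a : ℕ) : RExp := .load a (.const 0)

/-- Powers with constant exponents. -/
def RExp.npow (e : RExp) : ℕ → RExp
  | 0 => .const 1
  | k + 1 => .mul (e.npow k) e

/-- The expression `n + 1 / σ`, in powers of which all parameters of the learner are measured. -/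
def RExp.scale : RExp := .add (.cast .size) (.div (.const 1) .sigma)

variable {m : Mem}

@[simp] theorem NExp.eval_reg (a : ℕ) : (NExp.reg a).eval I m = m.nat a 0 := rfl

@[simp] theorem RExp.eval_reg (a : ℕ) : (RExp.reg a).eval I m = m.real a 0 := rfl

@[simp] theorem RExp.eval_npow (e : RExp) (k : ℕ) : (e.npow k).eval I m = e.eval I m ^ k := by
  induction k with
  | zero => simp [RExp.npow, RExp.eval]
  | succ k ih => simp [RExp.npow, RExp.eval, ih, pow_succ]

@[simp] theorem RExp.eval_scale : RExp.scale.eval I m = I.size + 1 / I.sigma := by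
  simp [RExp.scale, RExp.eval, NExp.eval]

theorem Cmd.run_seq (c c' : Cmd) (m : Mem) :
    (Cmd.seq c c').run U I m = c'.run U I (c.run U I m) := rfl

theorem Cmd.run_for {a : ℕ} {e : RExp} {c : Cmd} (K : ℕ) (he : e.eval I m = K)
    (P : ℕ → Mem → Prop) (zero : P 0 (m.tick (e.steps + 1)))
    (succ : ∀ k m', k < K → P k m' → P (k + 1) (c.run U I ((m'.storeN a 0 k).tick 1))) :
    P K ((Cmd.loop a e c).run U I m) := by
  have hK : ⌈e.eval I m⌉₊ = K := by rw [he, Nat.ceil_natCast]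
  simpa only [hK] using
    Cmd.run_loop_induction (U := U) P zero fun k m' hk => succ k m' (hK ▸ hk)

/-! Array usage. Integer arrays: `0` holds the number of grid points, `1` the current expert, `2` to
`5` are loop counters, and `6` holds the best vertex. Real arrays: `0` holds the action, `1` the
weights of the experts, `2` the indicator function of the unblocked vertices, `3` the total
weight of the solution, `4` the best key, `5` the degree, `6` the key, `7` a sum and `8` a
threshold. -/

/-- The indicator of the vertices that count for the degree, at the vertex in loop counter `4`. -/
def maskExp : GreedyVariant → RExp
  | .nonadaptive => .const 1
  | .adaptive => .load 2 (.reg 4)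

/-- Compute the degree of the vertex `v` in loop counter `3`. -/
def degCmd (V : GreedyVariant) : Cmd :=
  .seq (.setR 5 (.const 0) (.const 0))
    (.loop 4 (.cast .size) (.setR 5 (.const 0)
      (.add (.reg 5) (.mul (maskExp V) (.cast (.adj (.reg 3) (.reg 4)))))))

/-- Compute `w_v ^ N / (1 + deg v) ^ i`, where `N` is the number of grid points and `i` the current
expert. -/
def powCmd : Cmd :=
  .seq (.setR 6 (.const 0) (.const 1))
    (.loop 5 (.cast (.reg 0))
      (.seq (.setR 6 (.const 0) (.mul (.reg 6) (.weight (.reg 3))))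
        (.ite (.cast (.reg 5)) (.cast (.reg 1))
          (.setR 6 (.const 0) (.div (.reg 6) (.add (.const 1) (.reg 5)))) .skip)))

/-- Compute the key of `v`: the number of `powCmd` if `v` is unblocked, and `-1` otherwise. -/
def keyCmd (V : GreedyVariant) : Cmd :=
  .seq (degCmd V) (.seq powCmd (.setR 6 (.const 0)
    (.sub (.mul (.load 2 (.reg 3)) (.add (.reg 6) (.const 1))) (.const 1))))

/-- Find the first unblocked vertex of largest key. The result is `n` if there is none; weight and
adjacencies of `n` read as `0`, so that the rest of the greedy step then has no effect. -/
def argmaxCmd (V : GreedyVariant) : Cmd :=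
  .seq (.seq (.setR 4 (.const 0) (.const (-1))) (.setN 6 (.const 0) .size))
    (.loop 3 (.cast .size) (.seq (keyCmd V)
      (.ite (.reg 4) (.reg 6)
        (.seq (.setR 4 (.const 0) (.reg 6)) (.setN 6 (.const 0) (.reg 3))) .skip)))

/-- Block the neighbours of the best vertex. -/
def blockNeighborsCmd : Cmd :=
  .loop 4 (.cast .size) (.setR 2 (.reg 4)
    (.mul (.load 2 (.reg 4)) (.sub (.const 1) (.cast (.adj (.reg 6) (.reg 4))))))

/-- Block the best vertex and its neighbours. -/
def blockCmd : Cmd := .seq blockNeighborsCmd (.setR 2 (.reg 6) (.const 0))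

/-- One round of the greedy heuristic. -/
def stepCmd (V : GreedyVariant) : Cmd :=
  .seq (argmaxCmd V) (.seq (.setR 3 (.const 0) (.add (.reg 3) (.weight (.reg 6)))) blockCmd)

/-- Unblock all vertices. -/
def unblockCmd : Cmd := .loop 4 (.cast .size) (.setR 2 (.reg 4) (.const 1))

/-- The greedy heuristic with parameter `i / N`. -/
def greedyCmd (V : GreedyVariant) : Cmd :=
  .seq unblockCmd (.seq (.setR 3 (.const 0) (.const 0)) (.loop 2 (.cast .size) (stepCmd V)))

/-- Multiply the weight of every expert by `1 + cost / ((n + 1 / σ) ^ q * n)`. -/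
def updateCmd (V : GreedyVariant) (q : ℕ) : Cmd :=
  .loop 1 (.cast (.reg 0)) (.seq (greedyCmd V)
    (.setR 1 (.reg 1) (.mul (.load 1 (.reg 1))
      (.add (.const 1) (.div (.reg 3) (.mul (RExp.scale.npow q) (.cast .size)))))))

/-- Add up the weights of the experts. -/
def totalCmd : Cmd :=
  .seq (.setR 7 (.const 0) (.const 0))
    (.loop 1 (.cast (.reg 0)) (.setR 7 (.const 0) (.add (.reg 7) (.load 1 (.reg 1)))))

/-- Choose the action `k / N` for the last expert `k` such that the experts before it have total
weight at most the threshold. -/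
def pickCmd : Cmd :=
  .seq (.seq (.setR 7 (.const 0) (.const 0)) (.setR 0 (.const 0) (.const 0)))
    (.loop 1 (.cast (.reg 0)) (.seq
      (.ite (.reg 8) (.reg 7) .skip
        (.setR 0 (.const 0) (.div (.cast (.reg 1)) (.cast (.reg 0)))))
      (.setR 7 (.const 0) (.add (.reg 7) (.load 1 (.reg 1))))))

/-- Choose an expert with probability proportional to its weight. -/
def chooseCmd : Cmd :=
  .seq totalCmd (.seq
    (.seq (.draw 8 (.const 0)) (.setR 8 (.const 0) (.mul (.reg 8) (.reg 7)))) pickCmd)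

/-- Store the number `⌈(n + 1 / σ) ^ p⌉₊` of grid points. -/
def gridCmd (p : ℕ) : Cmd :=
  .loop 1 (RExp.scale.npow p) (.setN 0 (.const 0) (.add (.reg 1) (.const 1)))

/-- Set the weights of all experts to `1`. -/
def initCmd : Cmd := .loop 1 (.cast (.reg 0)) (.setR 1 (.reg 1) (.const 1))

end RealRAM

/-- Multiplicative weights on `⌈(n + 1 / σ) ^ p⌉₊` grid points with learning rate
`1 / (n + 1 / σ) ^ q`. -/
def Learner.hedge (V : GreedyVariant) (p q : ℕ) : Learner where
  start := .seq (gridCmd p) initCmd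
  choose := chooseCmd
  update := updateCmd V q

section Scan

variable {α : Type*} [LinearOrder α]

/-- The outcome of a linear search for the largest of `q 0, …, q (k - 1)` that starts with the
candidate `j₀` and replaces the candidate only by a strictly better index. -/
def scanMax (q : ℕ → α) (j₀ : ℕ) : ℕ → ℕ
  | 0 => j₀
  | k + 1 => if q (scanMax q j₀ k) < q k then k else scanMax q j₀ k

variable {q : ℕ → α} {j₀ : ℕ}

theorem le_scanMax_succ (k : ℕ) : q (scanMax q j₀ k) ≤ q (scanMax q j₀ (k + 1)) := by
  rw [scanMax]
  split_ifs with h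
  exacts [h.le, le_rfl]

theorem le_scanMax {j k : ℕ} (hj : j < k) : q j ≤ q (scanMax q j₀ k) := by
  induction k with
  | zero => exact absurd hj (Nat.not_lt_zero j)
  | succ k ih =>
    obtain hj | rfl := Nat.lt_succ_iff_lt_or_eq.1 hj
    · exact (ih hj).trans (le_scanMax_succ k)
    · rw [scanMax]
      split_ifs with h
      exacts [le_rfl, not_lt.1 h]

theorem scanMax_eq_or (k : ℕ) : scanMax q j₀ k = j₀ ∨
    scanMax q j₀ k < k ∧ q j₀ < q (scanMax q j₀ k) ∧
      ∀ j < scanMax q j₀ k, q j < q (scanMax q j₀ k) := by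
  induction k with
  | zero => exact Or.inl rfl
  | succ k ih =>
    rw [scanMax]
    split_ifs with h
    · refine Or.inr ⟨k.lt_succ_self, ?_, fun j hj => (le_scanMax hj).trans_lt h⟩
      obtain h₀ | ⟨-, h₀, -⟩ := ih
      exacts [h₀ ▸ h, h₀.trans h]
    · exact ih.imp_right fun ⟨hk, h₀, hj⟩ => ⟨hk.trans k.lt_succ_self, h₀, hj⟩

end Scan

namespace MWISInstance

variable {n : ℕ} {x : MWISInstance n} {V : GreedyVariant} {N i : ℕ} {S : Finset (Fin n)}

/-- The number by which the program ranks the vertices: the `N`-th power of the score for the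
parameter `i / N` if the vertex is in `S`, and `-1` otherwise. -/
def key (V : GreedyVariant) (N i : ℕ) (x : MWISInstance n) (S : Finset (Fin n)) (j : ℕ) : ℝ :=
  if h : j < n then
    if ⟨j, h⟩ ∈ S then x.weight ⟨j, h⟩ ^ N / (1 + (x.deg V S ⟨j, h⟩ : ℝ)) ^ i else -1
  else -1

theorem key_of_mem {v : Fin n} (hv : v ∈ S) :
    x.key V N i S v = x.weight v ^ N / (1 + (x.deg V S v : ℝ)) ^ i := by
  simp [key, hv]

theorem key_of_notMem {v : Fin n} (hv : v ∉ S) : x.key V N i S v = -1 := by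
  simp [key, hv]

theorem key_size : x.key V N i S n = -1 := by
  simp [key]

theorem key_nonneg (hx : ∀ v, 0 ≤ x.weight v) {v : Fin n} (hv : v ∈ S) :
    0 ≤ x.key V N i S v := by
  rw [key_of_mem hv]
  exact div_nonneg (pow_nonneg (hx v) _) (by positivity)

theorem key_eq_score_pow (hN : N ≠ 0) {v : Fin n} (hv : v ∈ S) :
    x.key V N i S v = x.score V ((i : ℝ) / N) S v ^ N := by
  have h0 : (0 : ℝ) ≤ 1 + (x.deg V S v : ℝ) := by positivity
  rw [key_of_mem hv, score, div_pow, ← Real.rpow_natCast ((1 + (x.deg V S v : ℝ)) ^ ((i : ℝ) / N)),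
    ← Real.rpow_mul h0, div_mul_cancel₀ _ (by exact_mod_cast hN), Real.rpow_natCast]

theorem key_le_key_iff (hN : N ≠ 0) (hx : ∀ v, 0 ≤ x.weight v) {u v : Fin n} (hu : u ∈ S)
    (hv : v ∈ S) : x.key V N i S u ≤ x.key V N i S v ↔
      x.score V ((i : ℝ) / N) S u ≤ x.score V ((i : ℝ) / N) S v := by
  have score_nonneg (v) : 0 ≤ x.score V ((i : ℝ) / N) S v :=
    div_nonneg (hx v) (Real.rpow_nonneg (by positivity) _)
  rw [key_eq_score_pow hN hu, key_eq_score_pow hN hv,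
    pow_le_pow_iff_left₀ (score_nonneg u) (score_nonneg v) hN]

theorem mem_best_iff_key (hN : N ≠ 0) (hx : ∀ v, 0 ≤ x.weight v) {v : Fin n} :
    v ∈ x.best V ((i : ℝ) / N) S ↔ v ∈ S ∧ ∀ u ∈ S, x.key V N i S u ≤ x.key V N i S v := by
  simp only [best, Finset.mem_filter]
  exact and_congr_right fun hv => forall₂_congr fun u hu => (key_le_key_iff hN hx hu hv).symm

theorem min'_best_eq_scanMax (hN : N ≠ 0) (hx : ∀ v, 0 ≤ x.weight v)
    (h : (x.best V ((i : ℝ) / N) S).Nonempty) :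
    ((x.best V ((i : ℝ) / N) S).min' h : ℕ) = scanMax (x.key V N i S) n n := by
  set q := x.key V N i S
  obtain ⟨v₀, hv₀⟩ := h
  have hv₀S : v₀ ∈ S := ((mem_best_iff_key hN hx).1 hv₀).1
  obtain hs | ⟨hlt, hq, hfirst⟩ := scanMax_eq_or (q := q) (j₀ := n) n
  · have hle : q v₀ ≤ -1 := by simpa only [hs, q, key_size] using le_scanMax (q := q) (j₀ := n) v₀.2
    linarith [key_nonneg (V := V) (N := N) (i := i) hx hv₀S]
  · set b : Fin n := ⟨scanMax q n n, hlt⟩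
    have hbS : b ∈ S := by
      by_contra hbS
      exact hq.ne (key_size.trans (key_of_notMem hbS).symm)
    have hb : b ∈ x.best V ((i : ℝ) / N) S :=
      (mem_best_iff_key hN hx).2 ⟨hbS, fun u _ => le_scanMax u.2⟩
    refine congrArg Fin.val (le_antisymm (Finset.min'_le _ _ hb) (Finset.le_min' _ _ _ ?_))
    intro v hv
    by_contra hlt
    exact (hfirst v (not_le.1 hlt)).not_ge (((mem_best_iff_key hN hx).1 hv).2 b hbS)

theorem scanMax_key_eq_size (hN : N ≠ 0) (hx : ∀ v, 0 ≤ x.weight v)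
    (h : ¬(x.best V ((i : ℝ) / N) S).Nonempty) : scanMax (x.key V N i S) n n = n := by
  refine (scanMax_eq_or n).resolve_right fun ⟨hlt, hq, _⟩ => h ⟨⟨_, hlt⟩, ?_⟩
  refine (mem_best_iff_key hN hx).2 ⟨?_, fun u _ => le_scanMax u.2⟩
  by_contra hS
  exact hq.ne (key_size.trans (key_of_notMem hS).symm)

open Classical in
theorem greedy_succ {ρ : ℝ} (h : (x.best V ρ S).Nonempty) (k : ℕ) :
    x.greedy V ρ (k + 1) S = insert ((x.best V ρ S).min' h) (x.greedy V ρ k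
      (S.filter fun u => u ≠ (x.best V ρ S).min' h ∧ ¬ x.graph.Adj ((x.best V ρ S).min' h) u)) := by
  rw [greedy, dif_pos h]

theorem greedy_eq_empty {ρ : ℝ} (h : ¬ (x.best V ρ S).Nonempty) (k : ℕ) :
    x.greedy V ρ k S = ∅ := by
  cases k with
  | zero => rfl
  | succ k => rw [greedy, dif_neg h]

theorem greedy_subset (ρ : ℝ) (k : ℕ) (S : Finset (Fin n)) : x.greedy V ρ k S ⊆ S := by
  classical
  induction k generalizing S with
  | zero => exact Finset.empty_subset _
  | succ k ih =>
    by_cases h : (x.best V ρ S).Nonempty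
    · rw [greedy_succ h]
      exact Finset.insert_subset (Finset.filter_subset _ _ (Finset.min'_mem _ h))
        ((ih _).trans (Finset.filter_subset _ _))
    · exact greedy_eq_empty h _ ▸ Finset.empty_subset _

end MWISInstance

namespace RealRAM

variable {n N i q : ℕ} {σ : ℝ} {x : MWISInstance n} {V : GreedyVariant} {S : Finset (Fin n)}
  {U : ℕ → unitInterval} {I : Input} {m : Mem}

@[simp] theorem instanceInput_size : (instanceInput σ x).size = n := rfl

@[simp] theorem instanceInput_sigma : (instanceInput σ x).sigma = σ := rfl

open Classical in
@[simp] theorem instanceInput_adj (v u : Fin n) :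
    (instanceInput σ x).adj v u = if x.graph.Adj v u then 1 else 0 := by
  simp [instanceInput]

@[simp] theorem instanceInput_adj_size (u : ℕ) : (instanceInput σ x).adj n u = 0 := by
  simp [instanceInput]

@[simp] theorem instanceInput_weight (v : Fin n) :
    (instanceInput σ x).weight v = x.weight v := by
  simp [instanceInput]

@[simp] theorem instanceInput_weight_size : (instanceInput σ x).weight n = 0 := by
  simp [instanceInput]

/-- The array `f` represents the set `S` of vertices by its indicator function; its entries from
index `n` on are irrelevant. -/
def IsIndicator (S : Finset (Fin n)) (f : ℕ → ℝ) : Prop :=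
  ∀ u : Fin n, f u = if u ∈ S then 1 else 0

theorem run_degCmd (hS : IsIndicator S (m.real 2)) (v : Fin n) (hv : m.nat 3 0 = v) :
    ((degCmd V).run U (instanceInput σ x) m).real 5 0 = x.deg V S v := by
  classical
  let f : ℕ → ℝ := fun u => match V with
    | .nonadaptive => (instanceInput σ x).adj v u
    | .adaptive => m.real 2 u * (instanceInput σ x).adj v u
  have sum_f : ∑ u ∈ Finset.range n, f u = x.deg V S v := by
    rw [Finset.sum_range]
    cases V <;> simp [f, MWISInstance.deg, hS _, Finset.sum_ite, Finset.filter_inter]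
  rw [degCmd, Cmd.run_seq, ← sum_f]
  refine (Cmd.run_for n rfl (fun k m' => m'.nat 3 0 = v ∧ m'.real 2 = m.real 2 ∧
    m'.real 5 0 = ∑ u ∈ Finset.range k, f u) ?_ ?_).2.2
  · simp [Cmd.run, RExp.eval, NExp.eval, hv]
  · rintro k m' - ⟨h3, h2, h5⟩
    refine ⟨by simp [Cmd.run, h3], by simp [Cmd.run, h2], ?_⟩
    rw [Finset.sum_range_succ]
    cases V <;> simp [Cmd.run, RExp.eval, NExp.eval, h3, h2, h5, maskExp, f]

theorem run_powCmd (hN : m.nat 0 0 = N) (hi : m.nat 1 0 = i) (hiN : i ≤ N) (v : Fin n)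
    (hv : m.nat 3 0 = v) :
    (powCmd.run U (instanceInput σ x) m).real 6 0 = x.weight v ^ N / (1 + m.real 5 0) ^ i := by
  rw [powCmd, Cmd.run_seq, ← min_eq_right hiN]
  refine (Cmd.run_for N (by simp [RExp.eval, Cmd.run, hN]) (fun k m' => m'.nat 1 0 = i ∧
    m'.nat 3 0 = v ∧ m'.real 5 = m.real 5 ∧
    m'.real 6 0 = x.weight v ^ k / (1 + m.real 5 0) ^ (min k i)) ?_ ?_).2.2.2
  · simp [Cmd.run, RExp.eval, NExp.eval, hi, hv]
  · rintro k m' - ⟨h1, h3, h5, h6⟩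
    by_cases hki : k < i
    · have hmin : min k i = k ∧ min (k + 1) i = k + 1 := by omega
      simp [Cmd.run, RExp.eval, NExp.eval, h1, h3, h5, h6, hki, hmin, pow_succ,
        div_mul_eq_mul_div, div_div]
    · have hmin : min k i = i ∧ min (k + 1) i = i := by omega
      simp [Cmd.run, RExp.eval, NExp.eval, h1, h3, h5, h6, hki, hmin, pow_succ,
        div_mul_eq_mul_div]

theorem run_keyCmd (hN : m.nat 0 0 = N) (hi : m.nat 1 0 = i) (hiN : i ≤ N)
    (hS : IsIndicator S (m.real 2)) {k : ℕ} (hk : k < n) (hv : m.nat 3 0 = k) :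
    ((keyCmd V).run U (instanceInput σ x) m).real 6 0 = x.key V N i S k := by
  have hdeg := run_degCmd (U := U) (σ := σ) (x := x) (V := V) hS ⟨k, hk⟩ hv
  rw [keyCmd, Cmd.run_seq, Cmd.run_seq]
  set m₁ := (degCmd V).run U (instanceInput σ x) m
  have nat₁ (a) (h : (degCmd V).writes (.nat a) = false) : m₁.nat a = m.nat a := Cmd.run_nat h m
  have hpow := run_powCmd (U := U) (σ := σ) (x := x) (by rw [nat₁ 0 rfl, hN])
    (by rw [nat₁ 1 rfl, hi]) hiN ⟨k, hk⟩ (by rw [nat₁ 3 rfl, hv])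
  rw [hdeg] at hpow
  have hmask : (powCmd.run U (instanceInput σ x) m₁).real 2 = m.real 2 :=
    (Cmd.run_real rfl m₁).trans (Cmd.run_real rfl m)
  have hvertex : (powCmd.run U (instanceInput σ x) m₁).nat 3 0 = k := by
    rw [Cmd.run_nat rfl, nat₁ 3 rfl, hv]
  have hk' : m.real 2 k = if (⟨k, hk⟩ : Fin n) ∈ S then 1 else 0 := hS ⟨k, hk⟩
  simp only [Cmd.run, RExp.eval, NExp.eval, RExp.eval_reg, NExp.eval_reg, Mem.storeR_real,
    Mem.tick_real, Function.update_self, hmask, hvertex, hpow, hk', MWISInstance.key, dif_pos hk]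
  split_ifs <;> simp

theorem run_argmaxCmd (hN : m.nat 0 0 = N) (hi : m.nat 1 0 = i) (hiN : i ≤ N)
    (hS : IsIndicator S (m.real 2)) :
    ((argmaxCmd V).run U (instanceInput σ x) m).nat 6 0 = scanMax (x.key V N i S) n n := by
  rw [argmaxCmd, Cmd.run_seq]
  refine (Cmd.run_for n rfl (fun k m' => m'.nat 0 = m.nat 0 ∧ m'.nat 1 = m.nat 1 ∧
    m'.real 2 = m.real 2 ∧ m'.real 4 0 = x.key V N i S (scanMax (x.key V N i S) n k) ∧
    m'.nat 6 0 = scanMax (x.key V N i S) n k) ?_ ?_).2.2.2.2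
  · simp [Cmd.run, RExp.eval, NExp.eval, scanMax, MWISInstance.key_size]
  · rintro k m' hk ⟨h0, h1, h2, h4, h6⟩
    rw [Cmd.run_seq]
    have hkey := run_keyCmd (U := U) (σ := σ) (x := x) (V := V) (m := (m'.storeN 3 0 k).tick 1)
      (N := N) (i := i) (S := S) (by simp [h0, hN]) (by simp [h1, hi]) hiN (by simpa [h2] using hS)
      hk (by simp)
    have nat₁ (a) (h : (keyCmd V).writes (.nat a) = false) :=
      Cmd.run_nat (U := U) (I := instanceInput σ x) h ((m'.storeN 3 0 k).tick 1)
    have real₁ (a) (h : (keyCmd V).writes (.real a) = false) :=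
      Cmd.run_real (U := U) (I := instanceInput σ x) h ((m'.storeN 3 0 k).tick 1)
    rw [scanMax]
    split_ifs with h <;>
      simp [Cmd.run, NExp.eval, hkey, nat₁ 0 rfl, nat₁ 1 rfl, nat₁ 3 rfl, nat₁ 6 rfl,
        real₁ 2 rfl, real₁ 4 rfl, h0, h1, h2, h4, h6, h]

theorem run_blockNeighborsCmd {j : ℕ} (hj : j < I.size) :
    (blockNeighborsCmd.run U I m).real 2 j = m.real 2 j * (1 - I.adj (m.nat 6 0) j) := by
  refine ((Cmd.run_for I.size rfl (fun k m' => m'.nat 6 = m.nat 6 ∧ ∀ u, m'.real 2 u =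
    if u < k then m.real 2 u * (1 - I.adj (m.nat 6 0) u) else m.real 2 u) (by simp) ?_).2 j).trans
    (if_pos hj)
  rintro k m' - ⟨h6, h2⟩
  refine ⟨by simp [Cmd.run, h6], fun u => ?_⟩
  obtain rfl | hu := eq_or_ne u k
  · simp [Cmd.run, RExp.eval, NExp.eval, h6, h2]
  · simp [Cmd.run, h2, hu, hu.le_iff_lt]

theorem run_blockCmd {j : ℕ} (hj : j < I.size) :
    (blockCmd.run U I m).real 2 j =
      if j = m.nat 6 0 then 0 else m.real 2 j * (1 - I.adj (m.nat 6 0) j) := by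
  have hbest : (blockNeighborsCmd.run U I m).nat 6 = m.nat 6 := Cmd.run_nat rfl m
  rw [blockCmd, Cmd.run_seq]
  simp [Cmd.run, RExp.eval, Function.update_apply, hbest, run_blockNeighborsCmd hj]

theorem isIndicator_run_blockCmd_size (hS : IsIndicator S (m.real 2)) (h6 : m.nat 6 0 = n) :
    IsIndicator S ((blockCmd.run U (instanceInput σ x) m).real 2) := fun u => by
  simp [run_blockCmd (I := instanceInput σ x) u.2, h6, u.2.ne, hS u]

open Classical in
theorem isIndicator_run_blockCmd (hS : IsIndicator S (m.real 2)) (v : Fin n)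
    (h6 : m.nat 6 0 = v) : IsIndicator (S.filter fun u => u ≠ v ∧ ¬ x.graph.Adj v u)
      ((blockCmd.run U (instanceInput σ x) m).real 2) := fun u => by
  rw [run_blockCmd u.2, h6, instanceInput_adj, hS u]
  by_cases huv : u = v <;> by_cases hadj : x.graph.Adj v u <;> simp [huv, hadj, Fin.val_inj]

theorem run_stepCmd (hN0 : N ≠ 0) (hN : m.nat 0 0 = N) (hi : m.nat 1 0 = i) (hiN : i ≤ N)
    (hx : ∀ v, 0 ≤ x.weight v) (hS : IsIndicator S (m.real 2)) :
    ∃ S', IsIndicator S' (((stepCmd V).run U (instanceInput σ x) m).real 2) ∧ ∀ k,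
      ((stepCmd V).run U (instanceInput σ x) m).real 3 0 +
          ∑ v ∈ x.greedy V ((i : ℝ) / N) k S', x.weight v =
        m.real 3 0 + ∑ v ∈ x.greedy V ((i : ℝ) / N) (k + 1) S, x.weight v := by
  classical
  have hargmax := run_argmaxCmd (U := U) (σ := σ) (x := x) (V := V) hN hi hiN hS
  have hmask : ((argmaxCmd V).run U (instanceInput σ x) m).real 2 = m.real 2 := Cmd.run_real rfl m
  have htotal : ((argmaxCmd V).run U (instanceInput σ x) m).real 3 = m.real 3 := Cmd.run_real rfl m
  rw [stepCmd, Cmd.run_seq, Cmd.run_seq]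
  set m₁ := (argmaxCmd V).run U (instanceInput σ x) m
  set m₂ := (Cmd.setR 3 (.const 0) (.add (.reg 3) (.weight (.reg 6)))).run U (instanceInput σ x) m₁
  have hS₂ : IsIndicator S (m₂.real 2) := by simpa [m₂, Cmd.run, hmask] using hS
  have hbest : m₂.nat 6 0 = scanMax (x.key V N i S) n n := hargmax
  have hresult : (blockCmd.run U (instanceInput σ x) m₂).real 3 0 =
      m.real 3 0 + (instanceInput σ x).weight (m₂.nat 6 0) := by
    rw [Cmd.run_real rfl]
    simp [m₂, Cmd.run, RExp.eval, NExp.eval, htotal]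
  by_cases h : (x.best V ((i : ℝ) / N) S).Nonempty
  · rw [← MWISInstance.min'_best_eq_scanMax hN0 hx h] at hbest
    refine ⟨_, isIndicator_run_blockCmd hS₂ _ hbest, fun k => ?_⟩
    rw [hresult, hbest, instanceInput_weight, MWISInstance.greedy_succ h, Finset.sum_insert,
      add_assoc]
    exact fun hmem => by simpa using MWISInstance.greedy_subset _ _ _ hmem
  · rw [MWISInstance.scanMax_key_eq_size hN0 hx h] at hbest
    refine ⟨S, isIndicator_run_blockCmd_size hS₂ hbest, fun k => ?_⟩
    rw [MWISInstance.greedy_eq_empty h, MWISInstance.greedy_eq_empty h, hresult, hbest,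
      instanceInput_weight_size, add_zero]

theorem isIndicator_run_unblockCmd :
    IsIndicator (n := n) Finset.univ
      ((unblockCmd.run U (instanceInput σ x) m).real 2) := fun u => by
  refine (Cmd.run_for n rfl (fun k m' => ∀ u < k, m'.real 2 u = 1) (by simp) ?_ u u.2).trans
    (by simp)
  intro k m' _ h u hu
  obtain rfl | huk := eq_or_ne u k
  · simp [Cmd.run, RExp.eval]
  · simp [Cmd.run, huk, h u (by omega)]

theorem run_greedyCmd (hN0 : N ≠ 0) (hN : m.nat 0 0 = N) (hi : m.nat 1 0 = i)
    (hiN : i ≤ N) (hx : ∀ v, 0 ≤ x.weight v) :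
    ((greedyCmd V).run U (instanceInput σ x) m).real 3 0 = x.cost V ((i : ℝ) / N) := by
  have hmask := isIndicator_run_unblockCmd (U := U) (σ := σ) (x := x) (m := m)
  have hN₁ : (unblockCmd.run U (instanceInput σ x) m).nat 0 = m.nat 0 := Cmd.run_nat rfl m
  have hi₁ : (unblockCmd.run U (instanceInput σ x) m).nat 1 = m.nat 1 := Cmd.run_nat rfl m
  rw [greedyCmd, Cmd.run_seq, Cmd.run_seq]
  obtain ⟨-, -, S, -, hcost⟩ := Cmd.run_for (U := U) (I := instanceInput σ x) (a := 2)
    (e := .cast .size) (c := stepCmd V) (m := (Cmd.setR 3 (.const 0) (.const 0)).run U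
      (instanceInput σ x) (unblockCmd.run U (instanceInput σ x) m)) n rfl
    (fun k m' => m'.nat 0 0 = N ∧ m'.nat 1 0 = i ∧ ∃ S : Finset (Fin n),
      IsIndicator S (m'.real 2) ∧
      m'.real 3 0 + ∑ v ∈ x.greedy V ((i : ℝ) / N) (n - k) S, x.weight v =
        x.cost V ((i : ℝ) / N))
    ⟨by simp [Cmd.run, hN₁, hN], by simp [Cmd.run, hi₁, hi], Finset.univ,
      by simpa [Cmd.run] using hmask,
      by simp [Cmd.run, RExp.eval, NExp.eval, MWISInstance.cost, MWISInstance.output]⟩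
    (by
      rintro k m' hk ⟨h0, h1, S, hS, hc⟩
      obtain ⟨S', hS', hc'⟩ := run_stepCmd (U := U) (σ := σ) (x := x) (V := V)
        (m := (m'.storeN 2 0 k).tick 1) (i := i) hN0 (by simp [h0]) (by simp [h1]) hiN hx
        (S := S) (by simpa using hS)
      refine ⟨by rw [Cmd.run_nat rfl]; simp [h0], by rw [Cmd.run_nat rfl]; simp [h1], S', hS', ?_⟩
      rw [hc', ← hc, show n - (k + 1) + 1 = n - k by omega]
      rfl)
  simpa [MWISInstance.greedy] using hcost

theorem run_updateCmd (hN : m.nat 0 0 = N) (hx : ∀ v, 0 ≤ x.weight v) {j : ℕ} (hj : j < N) :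
    ((updateCmd V q).run U (instanceInput σ x) m).real 1 j =
      m.real 1 j * (1 + x.cost V ((j : ℝ) / N) / (((n : ℝ) + 1 / σ) ^ q * n)) := by
  have hloop := Cmd.run_for (U := U) (I := instanceInput σ x) (a := 1) (e := .cast (.reg 0))
    (c := .seq (greedyCmd V) (.setR 1 (.reg 1) (.mul (.load 1 (.reg 1))
      (.add (.const 1) (.div (.reg 3) (.mul (RExp.scale.npow q) (.cast .size)))))))
    (m := m) N (by simp [RExp.eval, hN])
    (fun k m' => m'.nat 0 0 = N ∧ ∀ i, m'.real 1 i = if i < k then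
      m.real 1 i * (1 + x.cost V ((i : ℝ) / N) / (((n : ℝ) + 1 / σ) ^ q * n)) else m.real 1 i)
    ⟨hN, by simp⟩
    (by
      rintro k m' hk ⟨h0, h1⟩
      have hcost := run_greedyCmd (U := U) (σ := σ) (x := x) (V := V)
        (m := (m'.storeN 1 0 k).tick 1) (i := k) (N := N) (by omega) (by simp [h0]) (by simp)
        hk.le hx
      have nat₁ (a) (h : (greedyCmd V).writes (.nat a) = false) :=
        Cmd.run_nat (U := U) (I := instanceInput σ x) h ((m'.storeN 1 0 k).tick 1)
      have hweights := Cmd.run_real (U := U) (I := instanceInput σ x) (a := 1) (c := greedyCmd V)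
        rfl ((m'.storeN 1 0 k).tick 1)
      refine ⟨by simp [Cmd.run, nat₁ 0 rfl, h0], fun j => ?_⟩
      obtain rfl | hjk := eq_or_ne j k
      · simp [Cmd.run, RExp.eval, NExp.eval, nat₁ 1 rfl, hweights, hcost, h1]
      · simp [Cmd.run, nat₁ 1 rfl, hweights, hjk, h1, hjk.le_iff_lt])
  rw [updateCmd, hloop.2, if_pos hj]

theorem run_totalCmd (hN : m.nat 0 0 = N) :
    (totalCmd.run U I m).real 7 0 = ∑ j ∈ Finset.range N, m.real 1 j := by
  rw [totalCmd, Cmd.run_seq]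
  refine (Cmd.run_for N (by simp [RExp.eval, Cmd.run, hN]) (fun k m' => m'.real 1 = m.real 1 ∧
    m'.real 7 0 = ∑ j ∈ Finset.range k, m.real 1 j) (by simp [Cmd.run, NExp.eval, RExp.eval]) ?_).2
  rintro k m' - ⟨h1, h7⟩
  simp [Cmd.run, NExp.eval, RExp.eval, h1, h7, Finset.sum_range_succ]

/-- The last index `k < N` whose partial sum `∑ j < k, W j` is at most `τ`, or `0` if there is
none. -/
def pick (W : ℕ → ℝ) (τ : ℝ) : ℕ → ℕ
  | 0 => 0
  | k + 1 => if τ < ∑ j ∈ Finset.range k, W j then pick W τ k else k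

theorem run_pickCmd (hN : m.nat 0 0 = N) :
    (pickCmd.run U I m).real 0 0 = (pick (m.real 1) (m.real 8 0) N : ℝ) / N := by
  rw [pickCmd, Cmd.run_seq]
  refine (Cmd.run_for N (by simp [RExp.eval, Cmd.run, hN]) (fun k m' => m'.nat 0 0 = N ∧
    m'.real 1 = m.real 1 ∧ m'.real 8 0 = m.real 8 0 ∧
    m'.real 7 0 = ∑ j ∈ Finset.range k, m.real 1 j ∧
    m'.real 0 0 = (pick (m.real 1) (m.real 8 0) k : ℝ) / N)
    (by simp [Cmd.run, NExp.eval, RExp.eval, pick, hN]) ?_).2.2.2.2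
  rintro k m' - ⟨h0, h1, h8, h7, hpick⟩
  by_cases h : m.real 8 0 < ∑ j ∈ Finset.range k, m.real 1 j <;>
    simp [Cmd.run, NExp.eval, RExp.eval, h0, h1, h8, h7, hpick, pick, h, Finset.sum_range_succ]

theorem run_chooseCmd (hN : m.nat 0 0 = N) :
    (chooseCmd.run U I m).real 0 0 =
      (pick (m.real 1) (U m.draws * ∑ j ∈ Finset.range N, m.real 1 j) N : ℝ) / N := by
  have hN₁ : (totalCmd.run U I m).nat 0 = m.nat 0 := Cmd.run_nat rfl m
  have hW : (totalCmd.run U I m).real 1 = m.real 1 := Cmd.run_real rfl m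
  have hdraws : (totalCmd.run U I m).draws = m.draws := Cmd.run_draws rfl m
  rw [chooseCmd, Cmd.run_seq, Cmd.run_seq,
    run_pickCmd (N := N) (by simp [Cmd.run, NExp.eval, hN₁, hN])]
  simp [Cmd.run, RExp.eval, NExp.eval, run_totalCmd hN, hW, hdraws]

theorem run_chooseCmd_draws : (chooseCmd.run U I m).draws = m.draws + 1 := by
  have htotal : (totalCmd.run U I m).draws = m.draws := Cmd.run_draws rfl m
  rw [chooseCmd, Cmd.run_seq, Cmd.run_seq]
  exact (Cmd.run_draws (c := pickCmd) rfl _).trans (congrArg (· + 1) htotal)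

end RealRAM

section MultiplicativeWeights

variable {ι : Type*} {s : Finset ι} {ε : ℝ} {g : ℕ → ι → ℝ}

/-- The weight that the multiplicative weights algorithm with learning rate `ε` gives to the expert
`i` before round `t`, where `g r i` is the gain of `i` in round `r`. -/
def multiplicativeWeight (ε : ℝ) (g : ℕ → ι → ℝ) (t : ℕ) (i : ι) : ℝ :=
  ∏ r ∈ Finset.range t, (1 + ε * g r i)

theorem multiplicativeWeight_succ (t : ℕ) (i : ι) :
    multiplicativeWeight ε g (t + 1) i = multiplicativeWeight ε g t i * (1 + ε * g t i) :=
  Finset.prod_range_succ _ t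

theorem multiplicativeWeight_pos (hε : 0 ≤ ε) {i : ι} (hg : ∀ t, 0 ≤ g t i) (t : ℕ) :
    0 < multiplicativeWeight ε g t i :=
  Finset.prod_pos fun r _ => by have := hg r; positivity

theorem measurable_multiplicativeWeight {Ω : Type*} [MeasurableSpace Ω] {G : Ω → ℕ → ι → ℝ} {i : ι}
    (hG : ∀ t, Measurable fun ω => G ω t i) (t : ℕ) :
    Measurable fun ω => multiplicativeWeight ε (G ω) t i :=
  Finset.measurable_prod _ fun r _ => ((hG r).const_mul ε).const_add 1

theorem sum_multiplicativeWeight_pos (hs : s.Nonempty) (hε : 0 ≤ ε)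
    (hg : ∀ t, ∀ i ∈ s, 0 ≤ g t i) (t : ℕ) : 0 < ∑ i ∈ s, multiplicativeWeight ε g t i :=
  Finset.sum_pos (fun i hi => multiplicativeWeight_pos hε (hg · i hi) t) hs

theorem sum_multiplicativeWeight_succ {t : ℕ} (h : ∑ i ∈ s, multiplicativeWeight ε g t i ≠ 0) :
    ∑ i ∈ s, multiplicativeWeight ε g (t + 1) i = (∑ i ∈ s, multiplicativeWeight ε g t i) *
      (1 + ε * s.centerMass (multiplicativeWeight ε g t) (g t)) := by
  rw [mul_add, mul_one, mul_left_comm, Finset.centerMass, smul_eq_mul, mul_inv_cancel_left₀ h,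
    Finset.mul_sum, ← Finset.sum_add_distrib]
  refine Finset.sum_congr rfl fun i _ => ?_
  rw [multiplicativeWeight_succ, smul_eq_mul]
  ring

theorem log_sum_multiplicativeWeight_le (hs : s.Nonempty) (hε : 0 ≤ ε)
    (hg : ∀ t, ∀ i ∈ s, 0 ≤ g t i) (T : ℕ) :
    Real.log (∑ i ∈ s, multiplicativeWeight ε g T i) ≤ Real.log s.card +
      ε * ∑ t ∈ Finset.range T, s.centerMass (multiplicativeWeight ε g t) (g t) := by
  induction T with
  | zero => simp [multiplicativeWeight]
  | succ T ih =>
    have hΦ := sum_multiplicativeWeight_pos hs hε hg T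
    have hmean : 0 ≤ s.centerMass (multiplicativeWeight ε g T) (g T) :=
      mul_nonneg (inv_nonneg.2 hΦ.le) (Finset.sum_nonneg fun i hi =>
        mul_nonneg (multiplicativeWeight_pos hε (hg · i hi) T).le (hg T i hi))
    have hfac : 0 < 1 + ε * s.centerMass (multiplicativeWeight ε g T) (g T) := by positivity
    rw [sum_multiplicativeWeight_succ hΦ.ne', Real.log_mul hΦ.ne' hfac.ne',
      Finset.sum_range_succ, mul_add]
    linarith [Real.log_le_sub_one_of_pos hfac]

theorem sub_sq_le_log_one_add {x : ℝ} (hx : 0 ≤ x) : x - x ^ 2 ≤ Real.log (1 + x) := by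
  have hx1 : 0 < 1 + x := by positivity
  refine le_trans ?_ (Real.one_sub_inv_le_log_of_pos hx1)
  rw [inv_eq_one_div, one_sub_div hx1.ne', le_div_iff₀ hx1]
  nlinarith [pow_nonneg hx 3]

theorem le_log_multiplicativeWeight (hε : 0 ≤ ε) {i : ι} (hg : ∀ t, g t i ∈ Icc (0 : ℝ) 1)
    (T : ℕ) :
    ε * ∑ t ∈ Finset.range T, g t i - T * ε ^ 2 ≤ Real.log (multiplicativeWeight ε g T i) := by
  have hfac (t : ℕ) : 0 ≤ ε * g t i := mul_nonneg hε (hg t).1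
  calc ε * ∑ t ∈ Finset.range T, g t i - T * ε ^ 2
      = ∑ t ∈ Finset.range T, (ε * g t i - ε ^ 2) := by
        rw [Finset.sum_sub_distrib, Finset.mul_sum, Finset.sum_const, Finset.card_range,
          nsmul_eq_mul]
    _ ≤ ∑ t ∈ Finset.range T, Real.log (1 + ε * g t i) := Finset.sum_le_sum fun t _ => by
        refine le_trans (sub_le_sub_left ?_ _) (sub_sq_le_log_one_add (hfac t))
        rw [mul_pow]
        exact mul_le_of_le_one_right (sq_nonneg ε) (pow_le_one₀ (hg t).1 (hg t).2)
    _ = Real.log (multiplicativeWeight ε g T i) :=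
        (Real.log_prod fun t _ => by linarith [hfac t]).symm

theorem multiplicativeWeight_regret_le (hε : 0 < ε) (hg : ∀ t, ∀ i ∈ s, g t i ∈ Icc (0 : ℝ) 1)
    (T : ℕ) {i : ι} (hi : i ∈ s) :
    ∑ t ∈ Finset.range T, g t i ≤
      ∑ t ∈ Finset.range T, s.centerMass (multiplicativeWeight ε g t) (g t) +
        ε * T + Real.log s.card / ε := by
  have hg0 : ∀ t, ∀ j ∈ s, 0 ≤ g t j := fun t j hj => (hg t j hj).1
  have hlow := le_log_multiplicativeWeight hε.le (hg · i hi) T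
  have hmono := Real.log_le_log (multiplicativeWeight_pos hε.le (hg0 · i hi) T)
    (Finset.single_le_sum (fun j hj => (multiplicativeWeight_pos hε.le (hg0 · j hj) T).le) hi)
  have hup := log_sum_multiplicativeWeight_le ⟨i, hi⟩ hε.le hg0 T
  refine le_of_mul_le_mul_left ?_ hε
  rw [mul_add, mul_add, mul_div_cancel₀ _ hε.ne']
  linarith

end MultiplicativeWeights

namespace RealRAM

variable {W : ℕ → ℝ} {τ : ℝ} {N : ℕ}

theorem pick_congr {W' : ℕ → ℝ} (h : ∀ i < N, W i = W' i) : pick W τ N = pick W' τ N := by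
  induction N with
  | zero => rfl
  | succ N ih =>
    rw [pick, pick, ih fun i hi => h i (hi.trans N.lt_succ_self),
      Finset.sum_congr rfl fun i hi => h i ((Finset.mem_range.1 hi).trans N.lt_succ_self)]

theorem pick_lt (hN : N ≠ 0) : pick W τ N < N := by
  induction N with
  | zero => exact absurd rfl hN
  | succ N ih =>
    rw [pick]
    split_ifs
    · rcases eq_or_ne N 0 with rfl | hN'
      · exact Nat.one_pos
      · exact (ih hN').trans N.lt_succ_self
    · exact N.lt_succ_self

theorem sum_range_pick_le (hτ : 0 ≤ τ) : ∑ j ∈ Finset.range (pick W τ N), W j ≤ τ := by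
  induction N with
  | zero => simpa [pick] using hτ
  | succ N ih =>
    rw [pick]
    split_ifs with h
    · exact ih
    · exact not_lt.1 h

theorem lt_sum_range_pick_succ (hτ : 0 ≤ τ) (h : τ < ∑ j ∈ Finset.range N, W j) :
    τ < ∑ j ∈ Finset.range (pick W τ N + 1), W j := by
  induction N with
  | zero => exact absurd h (by simpa using hτ)
  | succ N ih =>
    rw [pick]
    split_ifs with hlt
    · exact ih hlt
    · exact h

theorem measurable_pick {Ω : Type*} [MeasurableSpace Ω] {W : Ω → ℕ → ℝ} {τ : Ω → ℝ}
    (hW : ∀ i, Measurable fun ω => W ω i) (hτ : Measurable τ) (N : ℕ) :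
    Measurable fun ω => pick (W ω) (τ ω) N := by
  induction N with
  | zero => exact measurable_const
  | succ N ih =>
    simp only [pick]
    exact Measurable.ite (measurableSet_lt hτ (Finset.measurable_sum _ fun i _ => hW i)) ih
      measurable_const

theorem pick_eq_iff (hW : ∀ i, 0 ≤ W i) (hτ : 0 ≤ τ) (h : τ < ∑ j ∈ Finset.range N, W j) {i : ℕ} :
    pick W τ N = i ↔
      ∑ j ∈ Finset.range i, W j ≤ τ ∧ τ < ∑ j ∈ Finset.range (i + 1), W j := by
  have hmono : Monotone fun k => ∑ j ∈ Finset.range k, W j := fun k l hkl =>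
    Finset.sum_le_sum_of_subset_of_nonneg (Finset.range_mono hkl) fun j _ _ => hW j
  refine ⟨?_, fun ⟨hi, hi'⟩ => ?_⟩
  · rintro rfl
    exact ⟨sum_range_pick_le hτ, lt_sum_range_pick_succ hτ h⟩
  · exact le_antisymm
      (Nat.lt_succ_iff.1 (hmono.reflect_lt ((sum_range_pick_le hτ).trans_lt hi')))
      (Nat.lt_succ_iff.1 (hmono.reflect_lt (hi.trans_lt (lt_sum_range_pick_succ hτ h))))

theorem volume_pick_eq (hW : ∀ i, 0 ≤ W i) (hpos : 0 < ∑ j ∈ Finset.range N, W j) {k : ℕ}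
    (hk : k < N) :
    volume.real {u : unitInterval | pick W (u * ∑ j ∈ Finset.range N, W j) N = k} =
      W k / ∑ j ∈ Finset.range N, W j := by
  set S := ∑ j ∈ Finset.range N, W j
  have hc {l : ℕ} (hl : l ≤ N) : (∑ j ∈ Finset.range l, W j) / S ∈ unitInterval :=
    ⟨div_nonneg (Finset.sum_nonneg fun j _ => hW j) hpos.le, div_le_one_of_le₀
      (Finset.sum_le_sum_of_subset_of_nonneg (Finset.range_mono hl) fun j _ _ => hW j) hpos.le⟩
  have hcell : {u : unitInterval | pick W (u * S) N = k} =ᵐ[volume]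
      Ico (⟨_, hc hk.le⟩ : unitInterval) ⟨_, hc hk⟩ := by
    refine Filter.eventuallyEq_set.2 ?_
    filter_upwards [Measure.ae_ne volume (1 : unitInterval)] with u hu
    have hu1 : (u : ℝ) * S < S := mul_lt_of_lt_one_left hpos
      (lt_of_le_of_ne u.2.2 fun h => hu (Subtype.ext h))
    rw [pick_eq_iff hW (mul_nonneg u.2.1 hpos.le) hu1, mem_Ico,
      ← Subtype.coe_le_coe, ← Subtype.coe_lt_coe, div_le_iff₀ hpos, lt_div_iff₀ hpos]
  rw [measureReal_congr hcell, Measure.real, unitInterval.volume_Ico, ENNReal.toReal_ofReal] <;>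
    simp only [← sub_div, Finset.sum_range_succ_sub_sum]
  exact div_nonneg (hW k) hpos.le

theorem integral_pick (hW : ∀ i, 0 ≤ W i) (hpos : 0 < ∑ j ∈ Finset.range N, W j) (f : ℕ → ℝ) :
    ∫ u : unitInterval, f (pick W (u * ∑ j ∈ Finset.range N, W j) N) =
      (Finset.range N).centerMass W f := by
  set S := ∑ j ∈ Finset.range N, W j with hS
  have hN : N ≠ 0 := by
    rintro rfl
    exact hpos.ne (Finset.sum_range_zero W).symm
  have hmeas (k : ℕ) : MeasurableSet {u : unitInterval | pick W (u * S) N = k} :=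
    measurable_pick (W := fun _ => W) (fun _ => measurable_const)
      (measurable_subtype_coe.mul_const S) N (measurableSet_singleton k)
  have hsum (u : unitInterval) : f (pick W (u * S) N) = ∑ k ∈ Finset.range N,
      {u : unitInterval | pick W (u * S) N = k}.indicator (fun _ => f k) u := by
    simp only [indicator_apply, mem_ofPred_eq, Finset.sum_ite_eq, Finset.mem_range, pick_lt hN,
      if_true]
  simp_rw [hsum]
  rw [integral_finsetSum _ fun k _ => (integrable_const _).indicator (hmeas k),
    Finset.centerMass, Finset.smul_sum]
  refine Finset.sum_congr rfl fun k hk => ?_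
  rw [integral_indicator (hmeas k), setIntegral_const,
    volume_pick_eq hW hpos (Finset.mem_range.1 hk), smul_eq_mul, smul_eq_mul, smul_eq_mul,
    div_eq_inv_mul, mul_assoc]

end RealRAM

section Polynomial

open Polynomial

theorem cast_eval_le_mul_pow (P : ℕ[X]) {b : ℕ} {y : ℝ} (hb : b ≤ y) (hy : 1 ≤ y) :
    ((P.eval b : ℕ) : ℝ) ≤ (P.eval 1 : ℕ) * y ^ P.natDegree := by
  rw [eval_eq_sum_range, eval_eq_sum_range, Nat.cast_sum, Nat.cast_sum, Finset.sum_mul]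
  refine Finset.sum_le_sum fun i hi => ?_
  rw [one_pow, mul_one, Nat.cast_mul, Nat.cast_pow]
  refine mul_le_mul_of_nonneg_left ?_ (Nat.cast_nonneg _)
  exact (pow_le_pow_left₀ (Nat.cast_nonneg b) hb i).trans
    (pow_le_pow_right₀ hy (Finset.mem_range_succ_iff.1 hi))

end Polynomial

namespace RealRAM

variable {U : ℕ → unitInterval} {I : Input} {m : Mem} {p : ℕ}

theorem run_gridCmd (hm : m.nat 0 0 = 0) :
    ((gridCmd p).run U I m).nat 0 0 = ⌈((I.size : ℝ) + 1 / I.sigma) ^ p⌉₊ := by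
  have h := Cmd.run_loop_induction (U := U) (I := I) (a := 1) (e := RExp.scale.npow p)
    (c := .setN 0 (.const 0) (.add (.reg 1) (.const 1))) (m := m)
    (fun k m' => m'.nat 0 0 = k) hm fun k m' _ _ => by simp [Cmd.run, NExp.eval]
  rwa [RExp.eval_npow, RExp.eval_scale] at h

theorem time_run_gridCmd_le {B : ℕ} (hB : ⌈((I.size : ℝ) + 1 / I.sigma) ^ p⌉₊ ≤ B) :
    ((gridCmd p).run U I m).time ≤ m.time + (gridCmd p).timeBound.eval B := by
  set τ := (NExp.const 0).steps + ((NExp.reg 1).add (.const 1)).steps + 1 with hτ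
  have h := Cmd.run_loop_induction (U := U) (I := I) (a := 1) (e := RExp.scale.npow p)
    (c := .setN 0 (.const 0) (.add (.reg 1) (.const 1))) (m := m)
    (fun k m' => m'.time ≤ m.time + ((RExp.scale.npow p).steps + 1 + k * (1 + τ)))
    (by simp) fun k m' _ ih => by
      simp only [Cmd.run, Mem.tick_time, Mem.storeN_time, add_one_mul, ← hτ]
      omega
  rw [RExp.eval_npow, RExp.eval_scale] at h
  simp only [gridCmd, Cmd.timeBound, Polynomial.eval_add, Polynomial.eval_mul, Polynomial.eval_C,
    Polynomial.eval_X, Polynomial.eval_one]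
  exact h.trans (by gcongr)

theorem run_initCmd {N : ℕ} (hm : m.nat 0 0 = N) {i : ℕ} (hi : i < N) :
    (initCmd.run U I m).real 1 i = 1 := by
  refine Cmd.run_for (U := U) (I := I) (a := 1) (e := .cast (.reg 0))
    (c := .setR 1 (.reg 1) (.const 1)) (m := m) N (by simp [RExp.eval, hm])
    (fun k m' => ∀ i < k, m'.real 1 i = 1) (by simp) ?_ i hi
  intro k m' _ h i hi
  by_cases hik : i = k
  · simp [Cmd.run, RExp.eval, hik]
  · simp [Cmd.run, hik, h i (lt_of_le_of_ne (Nat.lt_succ_iff.1 hi) hik)]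

end RealRAM

namespace Learner

variable {n p q : ℕ} {σ : ℝ} {V : GreedyVariant} {x : ℕ → MWISInstance n} {U : ℕ → unitInterval}

/-- The number of grid points, that is, of experts. -/
def gridSize (n : ℕ) (σ : ℝ) (p : ℕ) : ℕ := ⌈((n : ℝ) + 1 / σ) ^ p⌉₊

/-- The gain of expert `i` of `N`, who always plays `i / N`, scaled to `[0, 1]`. -/
def gain (V : GreedyVariant) (N : ℕ) (x : ℕ → MWISInstance n) (t i : ℕ) : ℝ :=
  (x t).cost V ((i : ℝ) / N) / n

/-- The weight that `hedge V p q` gives to expert `i` of `N` before round `t`. -/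
def expertWeight (V : GreedyVariant) (σ : ℝ) (q N : ℕ) (x : ℕ → MWISInstance n) (t i : ℕ) : ℝ :=
  multiplicativeWeight (1 / ((n : ℝ) + 1 / σ) ^ q) (gain V N x) t i

/-- The expert that `hedge V p q` follows in round `t` if its draw is `u`. -/
def expert (V : GreedyVariant) (σ : ℝ) (p q : ℕ) (x : ℕ → MWISInstance n) (t : ℕ)
    (u : unitInterval) : ℕ :=
  pick (expertWeight V σ q (gridSize n σ p) x t)
    (u * ∑ j ∈ Finset.range (gridSize n σ p), expertWeight V σ q (gridSize n σ p) x t j)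
    (gridSize n σ p)

theorem hedge_memory_nat (t : ℕ) :
    ((hedge V p q).memory σ U x t).nat 0 0 = gridSize n σ p := by
  induction t with
  | zero =>
    rw [memory, hedge, Cmd.run_seq, Cmd.run_nat (c := initCmd) rfl, run_gridCmd rfl]
    rfl
  | succ t ih =>
    exact (congrFun (Cmd.run_nat (c := updateCmd V q) rfl _) 0).trans
      ((congrFun (Cmd.run_nat (c := chooseCmd) rfl _) 0).trans ih)

theorem hedge_choose_nat (t : ℕ) :
    (chooseCmd.run U (paramInput n σ) ((hedge V p q).memory σ U x t)).nat 0 0 =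
      gridSize n σ p := by
  rw [Cmd.run_nat rfl, hedge_memory_nat]

theorem hedge_memory_draws (t : ℕ) : ((hedge V p q).memory σ U x t).draws = t := by
  induction t with
  | zero => exact Cmd.run_draws (c := .seq (gridCmd p) initCmd) rfl _
  | succ t ih =>
    exact (Cmd.run_draws (c := updateCmd V q) rfl _).trans
      (run_chooseCmd_draws.trans (congrArg (· + 1) ih))

theorem hedge_memory_real (hx : ∀ t v, 0 ≤ (x t).weight v) (t : ℕ) {i : ℕ}
    (hi : i < gridSize n σ p) :
    ((hedge V p q).memory σ U x t).real 1 i = expertWeight V σ q (gridSize n σ p) x t i := by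
  induction t with
  | zero =>
    rw [memory, hedge, Cmd.run_seq, expertWeight, multiplicativeWeight, Finset.prod_range_zero]
    exact run_initCmd (run_gridCmd rfl) hi
  | succ t ih =>
    have hW : (chooseCmd.run U (paramInput n σ) ((hedge V p q).memory σ U x t)).real 1 =
        ((hedge V p q).memory σ U x t).real 1 := Cmd.run_real (c := chooseCmd) rfl _
    refine (run_updateCmd (hedge_choose_nat t) (hx t) hi).trans ?_
    rw [hW, ih, expertWeight, expertWeight, multiplicativeWeight_succ, gain, div_mul_div_comm,
      one_mul]

theorem hedge_action (hx : ∀ t v, 0 ≤ (x t).weight v) (t : ℕ) :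
    (hedge V p q).action σ U x t = (expert V σ p q x t (U t) : ℝ) / gridSize n σ p := by
  have hW : ∀ i < gridSize n σ p, ((hedge V p q).memory σ U x t).real 1 i =
      expertWeight V σ q (gridSize n σ p) x t i := fun i hi => hedge_memory_real hx t hi
  refine (run_chooseCmd (hedge_memory_nat t)).trans ?_
  rw [expert, hedge_memory_draws, pick_congr hW,
    Finset.sum_congr rfl fun i hi => hW i (Finset.mem_range.1 hi)]

theorem two_le_scale (hn : 1 ≤ n) (hσ : 0 < σ) (hσ1 : σ < 1) : 2 ≤ (n : ℝ) + 1 / σ := by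
  have hn' : (1 : ℝ) ≤ n := Nat.one_le_cast.2 hn
  linarith [(one_lt_one_div hσ hσ1).le]

theorem gridSize_pos (hn : 1 ≤ n) (hσ : 0 < σ) : 0 < gridSize n σ p :=
  Nat.ceil_pos.2 (by positivity)

theorem gridSize_le (hn : 1 ≤ n) (hσ : 0 < σ) (hσ1 : σ < 1) :
    (gridSize n σ p : ℝ) ≤ 2 * ((n : ℝ) + 1 / σ) ^ p := by
  have h1 : 1 ≤ ((n : ℝ) + 1 / σ) ^ p :=
    one_le_pow₀ (one_le_two.trans (two_le_scale hn hσ hσ1))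
  rw [gridSize]
  linarith [Nat.ceil_lt_add_one (zero_le_one.trans h1)]

theorem hedge_action_mem (hn : 1 ≤ n) (hσ : 0 < σ) (t : ℕ) :
    (hedge V p q).action σ U x t ∈ Icc (0 : ℝ) 1 := by
  rw [action, show (hedge V p q).choose = chooseCmd from rfl, run_chooseCmd (hedge_memory_nat t)]
  exact ⟨by positivity, div_le_one_of_le₀
    (Nat.cast_le.2 (pick_lt (gridSize_pos hn hσ).ne').le) (Nat.cast_nonneg _)⟩

theorem time_hedge_start_le {B : ℕ} (hB : gridSize n σ p ≤ B) :
    ((hedge V p q).memory σ U x 0).time ≤ (hedge V p q).start.timeBound.eval B := by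
  have hgrid := time_run_gridCmd_le (U := U) (I := paramInput n σ)
    (m := ⟨fun _ _ => 0, fun _ _ => 0, 0, 0⟩) hB
  have hinit := Cmd.run_time_le (U := U) (c := initCmd) (I := paramInput n σ) (B := B) rfl
    ⟨fun m hm => (Nat.ceil_natCast _).trans_le (hm.trans_le hB), trivial⟩ _
    (run_gridCmd (U := U) (I := paramInput n σ) (p := p)
      (m := ⟨fun _ _ => 0, fun _ _ => 0, 0, 0⟩) rfl)
  rw [zero_add] at hgrid
  rw [memory, hedge, Cmd.run_seq, Cmd.timeBound, Polynomial.eval_add]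
  exact hinit.trans (Nat.add_le_add_right hgrid _)

theorem time_hedge_round_le (t : ℕ) :
    ((hedge V p q).memory σ U x (t + 1)).time ≤ ((hedge V p q).memory σ U x t).time +
      (chooseCmd.timeBound.eval (n + gridSize n σ p) +
        (updateCmd V q).timeBound.eval (n + gridSize n σ p)) := by
  have hchoose := Cmd.run_time_le (U := U) (c := chooseCmd) (I := paramInput n σ)
    (B := n + gridSize n σ p) rfl
    (by simp +contextual [chooseCmd, totalCmd, pickCmd, Cmd.LoopsBounded, RExp.eval]) _
    (hedge_memory_nat (V := V) (σ := σ) (p := p) (q := q) (U := U) (x := x) t)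
  have hupdate := Cmd.run_time_le (U := U) (c := updateCmd V q) (I := instanceInput σ (x t))
    (B := n + gridSize n σ p) rfl
    (by simp +contextual [updateCmd, greedyCmd, unblockCmd, stepCmd, blockCmd, blockNeighborsCmd,
      argmaxCmd, keyCmd, powCmd, degCmd, Cmd.LoopsBounded, RExp.eval, NExp.eval]) _
    (hedge_choose_nat (V := V) (σ := σ) (p := p) (q := q) (U := U) (x := x) t)
  rw [← add_assoc]
  exact hupdate.trans (Nat.add_le_add_right hchoose _)

theorem exists_time_hedge_le (V : GreedyVariant) (p q : ℕ) : ∃ K : ℕ, ∀ (n : ℕ) (σ : ℝ)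
    (x : ℕ → MWISInstance n) (U : ℕ → unitInterval), 1 ≤ n → 0 < σ → σ < 1 →
    (((hedge V p q).memory σ U x 0).time : ℝ) ≤ K * ((n : ℝ) + 1 / σ) ^ K ∧
    ∀ t, (((hedge V p q).memory σ U x (t + 1)).time : ℝ) ≤
      ((hedge V p q).memory σ U x t).time + K * ((n : ℝ) + 1 / σ) ^ K := by
  set P := (hedge V p q).start.timeBound + (chooseCmd.timeBound + (updateCmd V q).timeBound) with hP
  refine ⟨P.eval 1 + (p + 2) * P.natDegree, fun n σ x U hn hσ hσ1 => ?_⟩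
  have hy := two_le_scale hn hσ hσ1
  set y := (n : ℝ) + 1 / σ
  have hbase : ((n + gridSize n σ p : ℕ) : ℝ) ≤ y ^ (p + 2) := by
    have hny : (n : ℝ) ≤ y := le_add_of_nonneg_right (by positivity)
    have hyp : 1 ≤ y ^ p := one_le_pow₀ (by linarith)
    have hN : (gridSize n σ p : ℝ) ≤ 2 * y ^ p := gridSize_le hn hσ hσ1
    rw [Nat.cast_add, pow_add]
    nlinarith [mul_nonneg (sub_nonneg.2 hyp) (sub_nonneg.2 hy)]
  have hbound : ((P.eval (n + gridSize n σ p) : ℕ) : ℝ) ≤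
      (P.eval 1 + (p + 2) * P.natDegree : ℕ) * y ^ (P.eval 1 + (p + 2) * P.natDegree) :=
    calc ((P.eval (n + gridSize n σ p) : ℕ) : ℝ)
        ≤ (P.eval 1 : ℕ) * (y ^ (p + 2)) ^ P.natDegree :=
          cast_eval_le_mul_pow P hbase (one_le_pow₀ (by linarith))
      _ ≤ _ := by
        rw [← pow_mul]
        gcongr <;> first | linarith | omega
  have heval : P.eval (n + gridSize n σ p) =
      (hedge V p q).start.timeBound.eval (n + gridSize n σ p) +
        (chooseCmd.timeBound.eval (n + gridSize n σ p) +
          (updateCmd V q).timeBound.eval (n + gridSize n σ p)) := by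
    simp only [hP, Polynomial.eval_add]
  constructor
  · refine le_trans (Nat.cast_le.2 ?_) hbound
    have := time_hedge_start_le (V := V) (q := q) (U := U) (x := x)
      (Nat.le_add_left (gridSize n σ p) n)
    omega
  · intro t
    refine le_trans ?_ (add_le_add_right hbound _)
    have := time_hedge_round_le (V := V) (p := p) (q := q) (σ := σ) (U := U) (x := x) t
    exact_mod_cast (by omega)

end Learner

namespace MWISInstance

variable {n : ℕ} {V : GreedyVariant}

/-- The parameters `ρ` and `ρ'` rank the scores of any two vertices with weights `w` in the same
way, whatever their degrees are. Denominators are cleared, and `a` and `b` stand for one plus the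
degrees. Vertices of equal degree are left out, as their ranking does not depend on the
parameter. -/
def SameOrder (w : Fin n → ℝ) (ρ ρ' : ℝ) : Prop :=
  ∀ u v : Fin n, u ≠ v → ∀ a ∈ Finset.Icc 1 n, ∀ b ∈ Finset.Icc 1 n, a ≠ b →
    (w u * (b : ℝ) ^ ρ ≤ w v * (a : ℝ) ^ ρ ↔ w u * (b : ℝ) ^ ρ' ≤ w v * (a : ℝ) ^ ρ')

theorem deg_lt (x : MWISInstance n) (S : Finset (Fin n)) (v : Fin n) : x.deg V S v < n := by
  classical
  have card_filter_lt (A : Finset (Fin n)) : (A.filter fun u => x.graph.Adj v u).card < n := by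
    calc (A.filter fun u => x.graph.Adj v u).card
        < (Finset.univ : Finset (Fin n)).card := by
          refine Finset.card_lt_card ((Finset.subset_univ _).ssubset_of_mem_notMem
            (Finset.mem_univ v) fun hv => ?_)
          exact x.graph.irrefl (Finset.mem_filter.1 hv).2
      _ = n := by rw [Finset.card_univ, Fintype.card_fin]
  cases V
  exacts [card_filter_lt _, card_filter_lt _]

theorem score_le_score_iff (x : MWISInstance n) (ρ : ℝ) (S : Finset (Fin n)) (u v : Fin n) :
    x.score V ρ S u ≤ x.score V ρ S v ↔
      x.weight u * ((x.deg V S v + 1 : ℕ) : ℝ) ^ ρ ≤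
        x.weight v * ((x.deg V S u + 1 : ℕ) : ℝ) ^ ρ := by
  have rpow_pos (v) : (0 : ℝ) < (1 + (x.deg V S v : ℝ)) ^ ρ :=
    Real.rpow_pos_of_pos (by positivity) _
  rw [score, score, div_le_div_iff₀ (rpow_pos u) (rpow_pos v)]
  push_cast
  rw [add_comm (1 : ℝ), add_comm (1 : ℝ)]

namespace SameOrder

variable {x : MWISInstance n} {ρ ρ' : ℝ}

theorem score_le_score_iff (h : SameOrder x.weight ρ ρ') (S : Finset (Fin n)) (u v : Fin n) :
    x.score V ρ S u ≤ x.score V ρ S v ↔ x.score V ρ' S u ≤ x.score V ρ' S v := by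
  obtain rfl | huv := eq_or_ne u v
  · exact iff_of_true le_rfl le_rfl
  rw [x.score_le_score_iff, x.score_le_score_iff]
  obtain hd | hd := eq_or_ne (x.deg V S u) (x.deg V S v)
  · have rpow_pos (ρ : ℝ) : (0 : ℝ) < ((x.deg V S v + 1 : ℕ) : ℝ) ^ ρ :=
      Real.rpow_pos_of_pos (by positivity) _
    rw [hd, mul_le_mul_iff_left₀ (rpow_pos ρ), mul_le_mul_iff_left₀ (rpow_pos ρ')]
  · have mem_Icc (v) : x.deg V S v + 1 ∈ Finset.Icc 1 n :=
      Finset.mem_Icc.2 ⟨Nat.le_add_left 1 _, x.deg_lt S v⟩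
    exact h u v huv _ (mem_Icc u) _ (mem_Icc v) fun h => hd (Nat.succ_injective h)

theorem greedy_eq (h : SameOrder x.weight ρ ρ') (k : ℕ) (S : Finset (Fin n)) :
    x.greedy V ρ k S = x.greedy V ρ' k S := by
  have best_eq (S) : x.best V ρ S = x.best V ρ' S := by
    simp only [best, h.score_le_score_iff]
  induction k generalizing S with
  | zero => rfl
  | succ k ih =>
    by_cases hb : (x.best V ρ S).Nonempty
    · have hb' : (x.best V ρ' S).Nonempty := best_eq S ▸ hb
      have min'_eq : (x.best V ρ S).min' hb = (x.best V ρ' S).min' hb' := by simp only [best_eq]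
      rw [greedy_succ hb, greedy_succ hb', ih, min'_eq]
    · rw [greedy_eq_empty hb, greedy_eq_empty (best_eq S ▸ hb)]

theorem cost_eq (h : SameOrder x.weight ρ ρ') : x.cost V ρ = x.cost V ρ' := by
  rw [cost, cost, output, output, h.greedy_eq]

end SameOrder

theorem cost_mem_Icc {x : MWISInstance n} (hx : ∀ v, x.weight v ∈ Icc (0 : ℝ) 1) (ρ : ℝ) :
    x.cost V ρ ∈ Icc (0 : ℝ) n := by
  refine ⟨Finset.sum_nonneg fun v _ => (hx v).1, ?_⟩
  calc x.cost V ρ ≤ (x.output V ρ).card • (1 : ℝ) :=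
        Finset.sum_le_card_nsmul _ _ _ fun v _ => (hx v).2
    _ = (x.output V ρ).card := nsmul_one _
    _ ≤ n := by exact_mod_cast (Finset.card_le_univ _).trans_eq (Fintype.card_fin n)

section Measurability

variable (G : SimpleGraph (Fin n))

theorem measurable_score (S : Finset (Fin n)) (v : Fin n) :
    Measurable fun p : ℝ × (Fin n → ℝ) => (⟨G, p.2⟩ : MWISInstance n).score V p.1 S v := by
  have deg_eq (w : Fin n → ℝ) :
      (⟨G, w⟩ : MWISInstance n).deg V S v = (⟨G, 0⟩ : MWISInstance n).deg V S v := by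
    cases V <;> rfl
  simp only [score, deg_eq]
  exact ((measurable_pi_apply v).comp measurable_snd).div (measurable_const.pow measurable_fst)

theorem measurable_best (S : Finset (Fin n)) :
    Measurable fun p : ℝ × (Fin n → ℝ) => (⟨G, p.2⟩ : MWISInstance n).best V p.1 S := by
  refine measurable_finset_iff.2 fun v => ?_
  simp only [best, Finset.mem_filter]
  exact measurable_const.and (Measurable.forall fun u => measurable_const.imp
    (measurableSet_setOfPred.1
      (measurableSet_le (measurable_score G S u) (measurable_score G S v))))

theorem measurable_greedy (k : ℕ) (S : Finset (Fin n)) :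
    Measurable fun p : ℝ × (Fin n → ℝ) => (⟨G, p.2⟩ : MWISInstance n).greedy V p.1 k S := by
  classical
  induction k generalizing S with
  | zero => exact measurable_const
  | succ k ih =>
    let next (B : Finset (Fin n)) (g : Finset (Fin n) → Finset (Fin n)) : Finset (Fin n) :=
      if h : B.Nonempty then
        insert (B.min' h) (g (S.filter fun u => u ≠ B.min' h ∧ ¬ G.Adj (B.min' h) u))
      else ∅
    have measurable_next : Measurable (Function.uncurry next) := measurable_of_countable _
    exact measurable_next.comp ((measurable_best G S).prodMk (measurable_pi_iff.2 ih))

theorem measurable_cost :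
    Measurable fun p : ℝ × (Fin n → ℝ) => (⟨G, p.2⟩ : MWISInstance n).cost V p.1 := by
  have measurable_sum :
      Measurable fun p : Finset (Fin n) × (Fin n → ℝ) => ∑ v ∈ p.1, p.2 v :=
    measurable_from_prod_countable_right fun A =>
      Finset.measurable_sum A fun v _ => measurable_pi_apply v
  exact measurable_sum.comp ((measurable_greedy G n Finset.univ).prodMk measurable_snd)

end Measurability

/-- The parameter `ρ` with `y * b ^ ρ = z * a ^ ρ`, if there is exactly one. -/
def crossingPoint (y z : ℝ) (a b : ℕ) : ℝ :=
  Real.log (y / z) / Real.log ((a : ℝ) / b)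

theorem eq_crossingPoint {a b : ℕ} (ha : 1 ≤ a) (hb : 1 ≤ b) (hab : a ≠ b) {y z r : ℝ}
    (hz : z ≠ 0) (h : y * (b : ℝ) ^ r = z * (a : ℝ) ^ r) : r = crossingPoint y z a b := by
  have ha0 : (0 : ℝ) < a := by exact_mod_cast ha
  have hb0 : (0 : ℝ) < b := by exact_mod_cast hb
  have hlog : Real.log ((a : ℝ) / b) ≠ 0 := by
    refine Real.log_ne_zero_of_pos_of_ne_one (by positivity) ?_
    rw [Ne, div_eq_one_iff_eq hb0.ne']
    exact_mod_cast hab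
  have hratio : y / z = ((a : ℝ) / b) ^ r := by
    rw [Real.div_rpow ha0.le hb0.le, div_eq_div_iff hz (Real.rpow_pos_of_pos hb0 r).ne', h,
      mul_comm]
  rw [crossingPoint, hratio, Real.log_rpow (by positivity), mul_div_cancel_right₀ _ hlog]

theorem eventually_le_iff {a b : ℕ} (ha : 1 ≤ a) (hb : 1 ≤ b) (hab : a ≠ b) {y z r : ℝ}
    (hr : r ≠ crossingPoint y z a b) :
    ∀ᶠ ρ in nhds r, (y * (b : ℝ) ^ r ≤ z * (a : ℝ) ^ r ↔ y * (b : ℝ) ^ ρ ≤ z * (a : ℝ) ^ ρ) := by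
  have cont (c : ℝ) {k : ℕ} (hk : 1 ≤ k) : ContinuousAt (fun ρ : ℝ => c * (k : ℝ) ^ ρ) r :=
    (continuous_const.mul (Real.continuous_const_rpow
      (Nat.cast_ne_zero.2 (Nat.one_le_iff_ne_zero.1 hk)))).continuousAt
  rcases lt_trichotomy (y * (b : ℝ) ^ r) (z * (a : ℝ) ^ r) with h | h | h
  · filter_upwards [(cont y hb).eventually_lt (cont z ha) h] with ρ hρ
    exact iff_of_true h.le hρ.le
  · have hz : z = 0 := by
      by_contra hz
      exact hr (eq_crossingPoint ha hb hab hz h)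
    have hy : y = 0 := by
      have hbr : (b : ℝ) ^ r ≠ 0 := (Real.rpow_pos_of_pos (by exact_mod_cast hb) r).ne'
      simpa [hz, hbr] using h
    simp [hy, hz]
  · filter_upwards [(cont z ha).eventually_lt (cont y hb) h] with ρ hρ
    exact iff_of_false (not_le.2 h) (not_le.2 hρ)

theorem eventually_sameOrder {w : Fin n → ℝ} {r : ℝ}
    (hr : ∀ u v a b, r ≠ crossingPoint (w u) (w v) a b) :
    ∀ᶠ ρ in nhds r, SameOrder w r ρ := by
  simp only [SameOrder, Filter.eventually_all, Finset.eventually_all]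
  intro u v _ a ha b hb hab
  exact eventually_le_iff (Finset.mem_Icc.1 ha).1 (Finset.mem_Icc.1 hb).1 hab (hr u v a b)

/-- Countably many parameters, depending on the weights, that suffice for the supremum over
`[0, 1]`: the rational numbers and the parameters at which two scores cross. -/
def selector (w : ℕ → Fin n → ℝ) :
    {q : ℚ // (q : ℝ) ∈ Icc (0 : ℝ) 1} ⊕ (ℕ × Fin n × Fin n × ℕ × ℕ) → Icc (0 : ℝ) 1
  | .inl q => ⟨q.1, q.2⟩
  | .inr (t, u, v, a, b) => projIcc 0 1 zero_le_one (crossingPoint (w t u) (w t v) a b)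

theorem exists_rat_mem_Icc_of_eventually {P : ℝ → Prop} {r : ℝ} (hr : r ∈ Icc (0 : ℝ) 1)
    (h : ∀ᶠ ρ in nhds r, P ρ) : ∃ q : ℚ, (q : ℝ) ∈ Icc (0 : ℝ) 1 ∧ P q := by
  obtain ⟨ε, hε, hball⟩ := Metric.eventually_nhds_iff.1 h
  have hlt : max 0 (r - ε) < min 1 (r + ε) := by
    rw [max_lt_iff, lt_min_iff, lt_min_iff]
    exact ⟨⟨one_pos, by linarith [hr.1]⟩, by linarith [hr.2], by linarith⟩
  obtain ⟨q, hq, hq'⟩ := exists_rat_btwn hlt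
  rw [max_lt_iff] at hq
  rw [lt_min_iff] at hq'
  refine ⟨q, ⟨hq.1.le, hq'.1.le⟩, hball ?_⟩
  rw [Real.dist_eq, abs_lt]
  exact ⟨by linarith, by linarith⟩

theorem exists_sum_cost_eq_selector (G : ℕ → SimpleGraph (Fin n)) (w : ℕ → Fin n → ℝ) (T : ℕ)
    (r : Icc (0 : ℝ) 1) : ∃ j, ∑ t ∈ Finset.range T, (instances G w t).cost V (selector w j) =
      ∑ t ∈ Finset.range T, (instances G w t).cost V r := by
  by_cases h : ∃ j, selector w (.inr j) = r
  · obtain ⟨j, hj⟩ := h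
    exact ⟨.inr j, by rw [hj]⟩
  have ne_crossing (t u v a b) : (r : ℝ) ≠ crossingPoint (w t u) (w t v) a b := fun he =>
    h ⟨(t, u, v, a, b), by rw [selector, ← he, projIcc_val]⟩
  have near_r : ∀ᶠ ρ in nhds (r : ℝ), ∀ t ∈ Finset.range T, SameOrder (w t) r ρ :=
    (Finset.eventually_all _).2 fun t _ => eventually_sameOrder (ne_crossing t)
  obtain ⟨q, hq, hqr⟩ := exists_rat_mem_Icc_of_eventually r.2 near_r
  exact ⟨.inl ⟨q, hq⟩, Finset.sum_congr rfl fun t ht => (SameOrder.cost_eq (hqr t ht)).symm⟩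

theorem measurable_selector
    (j : {q : ℚ // (q : ℝ) ∈ Icc (0 : ℝ) 1} ⊕ (ℕ × Fin n × Fin n × ℕ × ℕ)) :
    Measurable fun w : ℕ → Fin n → ℝ => (selector w j : ℝ) := by
  rcases j with q | ⟨t, u, v, a, b⟩
  · exact measurable_const
  · simp only [selector, coe_projIcc, crossingPoint]
    fun_prop

theorem measurable_iSup_cost (G : ℕ → SimpleGraph (Fin n)) (T : ℕ) :
    Measurable fun w : ℕ → Fin n → ℝ =>
      ⨆ r : Icc (0 : ℝ) 1, ∑ t ∈ Finset.range T, (instances G w t).cost V r := by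
  have iSup_eq (w : ℕ → Fin n → ℝ) :
      ⨆ r : Icc (0 : ℝ) 1, ∑ t ∈ Finset.range T, (instances G w t).cost V r =
        ⨆ j, ∑ t ∈ Finset.range T, (instances G w t).cost V (selector w j) := by
    refine congrArg sSup (Subset.antisymm ?_ ?_)
    · exact range_subset_iff.2 fun r => exists_sum_cost_eq_selector G w T r
    · exact range_subset_iff.2 fun j => mem_range_self (selector w j)
  simp only [iSup_eq]
  exact Measurable.iSup fun j => Finset.measurable_sum _ fun t _ =>
    (measurable_cost (G t)).comp ((measurable_selector j).prodMk (measurable_pi_apply t))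

/-- The weights for which some two scores may cross at a parameter between `i / N` and
`(i + 1) / N`. -/
def crossing (n N i : ℕ) : Set (Fin n → ℝ) :=
  ⋃ u, ⋃ v, ⋃ (_ : u ≠ v), ⋃ a ∈ Finset.Icc 1 n, ⋃ b ∈ Finset.Icc 1 n, ⋃ (_ : a < b),
    {w | w v ∈ Icc (w u * ((b : ℝ) / a) ^ ((i : ℝ) / N))
      (w u * ((b : ℝ) / a) ^ (((i : ℝ) + 1) / N))}

theorem measurableSet_crossing (n N i : ℕ) : MeasurableSet (crossing n N i) := by
  refine MeasurableSet.iUnion fun u => MeasurableSet.iUnion fun v => MeasurableSet.iUnion fun _ =>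
    Finset.measurableSet_biUnion _ fun a _ => Finset.measurableSet_biUnion _ fun b _ =>
    MeasurableSet.iUnion fun _ => ?_
  exact (measurableSet_le ((measurable_pi_apply u).mul_const _) (measurable_pi_apply v)).inter
    (measurableSet_le (measurable_pi_apply v) ((measurable_pi_apply u).mul_const _))

theorem lt_or_lt_of_notMem_crossing {N i : ℕ} {w : Fin n → ℝ} (hw : ∀ v, 0 ≤ w v)
    (h : w ∉ crossing n N i) {u v : Fin n} (huv : u ≠ v) {a b : ℕ} (ha : a ∈ Finset.Icc 1 n)
    (hb : b ∈ Finset.Icc 1 n) (hab : a < b) :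
    (∀ ρ ∈ Icc ((i : ℝ) / N) (((i : ℝ) + 1) / N), w v * (a : ℝ) ^ ρ < w u * (b : ℝ) ^ ρ) ∨
      ∀ ρ ∈ Icc ((i : ℝ) / N) (((i : ℝ) + 1) / N), w u * (b : ℝ) ^ ρ < w v * (a : ℝ) ^ ρ := by
  have ha0 : (0 : ℝ) < a := by exact_mod_cast (Finset.mem_Icc.1 ha).1
  have one_le_ratio : 1 ≤ (b : ℝ) / a := (one_le_div ha0).2 (by exact_mod_cast hab.le)
  have rpow_pos (ρ : ℝ) : 0 < (a : ℝ) ^ ρ := Real.rpow_pos_of_pos ha0 ρ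
  have factor (ρ : ℝ) : w u * (b : ℝ) ^ ρ = w u * ((b : ℝ) / a) ^ ρ * (a : ℝ) ^ ρ := by
    rw [mul_assoc, ← Real.mul_rpow (by positivity) ha0.le, div_mul_cancel₀ _ ha0.ne']
  have mono {ρ ρ' : ℝ} (hρ : ρ ≤ ρ') : w u * ((b : ℝ) / a) ^ ρ ≤ w u * ((b : ℝ) / a) ^ ρ' :=
    mul_le_mul_of_nonneg_left (Real.rpow_le_rpow_of_exponent_le one_le_ratio hρ) (hw u)
  simp only [factor, mul_lt_mul_iff_left₀ (rpow_pos _)]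
  simp only [crossing, mem_iUnion, not_exists, mem_ofPred_eq, mem_Icc, not_and, not_le] at h
  obtain hlt | hle := lt_or_ge (w v) (w u * ((b : ℝ) / a) ^ ((i : ℝ) / N))
  · exact Or.inl fun ρ hρ => hlt.trans_le (mono hρ.1)
  · exact Or.inr fun ρ hρ => (mono hρ.2).trans_lt (h u v huv a ha b hb hab hle)

theorem sameOrder_of_notMem_crossing {N i : ℕ} {w : Fin n → ℝ} (hw : ∀ v, 0 ≤ w v)
    (h : w ∉ crossing n N i) {r : ℝ} (hr : r ∈ Icc ((i : ℝ) / N) (((i : ℝ) + 1) / N)) :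
    SameOrder w r ((i : ℝ) / N) := by
  have hi : (i : ℝ) / N ∈ Icc ((i : ℝ) / N) (((i : ℝ) + 1) / N) := ⟨le_rfl, hr.1.trans hr.2⟩
  intro u v huv a ha b hb hab
  obtain hab | hba := lt_or_gt_of_ne hab
  · obtain hlt | hlt := lt_or_lt_of_notMem_crossing hw h huv ha hb hab
    · exact iff_of_false (not_le.2 (hlt _ hr)) (not_le.2 (hlt _ hi))
    · exact iff_of_true (hlt _ hr).le (hlt _ hi).le
  · obtain hlt | hlt := lt_or_lt_of_notMem_crossing hw h huv.symm hb ha hba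
    · exact iff_of_true (hlt _ hr).le (hlt _ hi).le
    · exact iff_of_false (not_le.2 (hlt _ hr)) (not_le.2 (hlt _ hi))

end MWISInstance

theorem IsSmooth.measure_Icc_le {σ : ℝ} {μ : Measure ℝ} (h : IsSmooth σ μ) (hσ : 0 < σ) (a b : ℝ) :
    μ (Icc a b) ≤ ENNReal.ofReal ((b - a) / σ) := by
  obtain ⟨f, -, hf, -, rfl⟩ := h
  rw [withDensity_apply _ measurableSet_Icc]
  calc ∫⁻ y in Icc a b, f y ≤ ∫⁻ _ in Icc a b, ENNReal.ofReal (1 / σ) := lintegral_mono hf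
    _ = ENNReal.ofReal (1 / σ) * ENNReal.ofReal (b - a) := by
      rw [setLIntegral_const, Real.volume_Icc]
    _ = ENNReal.ofReal ((b - a) / σ) := by
      rw [← ENNReal.ofReal_mul (by positivity), one_div_mul_eq_div]

theorem IsSmooth.ae_mem_Icc {σ : ℝ} {μ : Measure ℝ} (h : IsSmooth σ μ) :
    ∀ᵐ y ∂μ, y ∈ Icc (0 : ℝ) 1 := by
  obtain ⟨f, -, -, hf, rfl⟩ := h
  change (volume.withDensity f) (Icc (0 : ℝ) 1)ᶜ = 0
  rw [withDensity_apply _ measurableSet_Icc.compl]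
  exact setLIntegral_eq_zero measurableSet_Icc.compl hf

theorem map_pi_prodMk_eval {ι : Type*} [Fintype ι] {E : ι → Type*} [∀ v, MeasurableSpace (E v)]
    (μ : ∀ v, Measure (E v)) [∀ v, IsProbabilityMeasure (μ v)] {u v : ι} (huv : u ≠ v) :
    (Measure.pi μ).map (fun w => (w u, w v)) = (μ u).prod (μ v) := by
  have indep : IndepFun (fun w : ∀ i, E i => w u) (fun w => w v) (Measure.pi μ) :=
    (iIndepFun_pi (μ := μ) (X := fun _ => id) fun _ => aemeasurable_id).indepFun huv
  rw [(indepFun_iff_map_prod_eq_prod_map_map (measurable_pi_apply u).aemeasurable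
    (measurable_pi_apply v).aemeasurable).1 indep, (measurePreserving_eval μ u).map_eq,
    (measurePreserving_eval μ v).map_eq]

theorem IsSmooth.measureReal_pi_mem_Icc_mul_le {ι : Type*} [Fintype ι] {σ : ℝ} (hσ : 0 < σ)
    {μ : ι → Measure ℝ} [∀ v, IsProbabilityMeasure (μ v)] (hμ : ∀ v, IsSmooth σ (μ v)) {u v : ι}
    (huv : u ≠ v) {c c' : ℝ} (hc : c ≤ c') :
    (Measure.pi μ).real {w | w v ∈ Icc (w u * c) (w u * c')} ≤ (c' - c) / σ := by
  have hs : MeasurableSet {z : ℝ × ℝ | z.2 ∈ Icc (z.1 * c) (z.1 * c')} :=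
    (measurableSet_le (measurable_fst.mul_const _) measurable_snd).inter
      (measurableSet_le measurable_snd (measurable_fst.mul_const _))
  have map_eq := map_pi_prodMk_eval μ huv
  refine ENNReal.toReal_le_of_le_ofReal (div_nonneg (sub_nonneg.2 hc) hσ.le) ?_
  calc Measure.pi μ {w | w v ∈ Icc (w u * c) (w u * c')}
      = (μ u).prod (μ v) {z | z.2 ∈ Icc (z.1 * c) (z.1 * c')} := by
        rw [← map_eq, Measure.map_apply
          ((measurable_pi_apply u).prodMk (measurable_pi_apply v)) hs]
        rfl
    _ = ∫⁻ z, μ v (Icc (z * c) (z * c')) ∂μ u := Measure.prod_apply hs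
    _ ≤ ∫⁻ _, ENNReal.ofReal ((c' - c) / σ) ∂μ u := by
        refine lintegral_mono_ae ?_
        filter_upwards [(hμ u).ae_mem_Icc] with z hz
        refine ((hμ v).measure_Icc_le hσ _ _).trans (ENNReal.ofReal_le_ofReal ?_)
        rw [← mul_sub]
        gcongr
        exact mul_le_of_le_one_left (sub_nonneg.2 hc) hz.2
    _ = ENNReal.ofReal ((c' - c) / σ) := by rw [lintegral_const, measure_univ, mul_one]

theorem rpow_add_sub_rpow_le {c r h : ℝ} (hc : 1 ≤ c) (hr : r ≤ 1) (h0 : 0 ≤ h) (h1 : h ≤ 1) :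
    c ^ (r + h) - c ^ r ≤ c * (h * (c - 1)) := by
  have bernoulli : c ^ h - 1 ≤ h * (c - 1) := by
    have := rpow_one_add_le_one_add_mul_self (s := c - 1) (by linarith) h0 h1
    rw [add_sub_cancel] at this
    linarith
  have base : c ^ r ≤ c := by
    simpa only [Real.rpow_one] using Real.rpow_le_rpow_of_exponent_le hc hr
  rw [Real.rpow_add (by linarith), ← mul_sub_one]
  exact mul_le_mul base bernoulli (sub_nonneg.2 (Real.one_le_rpow hc h0)) (by linarith)

namespace MWISInstance

theorem rpow_ratio_sub_le {n N i a b : ℕ} (hi : i < N) (ha : 1 ≤ a) (hab : a < b) (hb : b ≤ n) :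
    ((b : ℝ) / a) ^ (((i : ℝ) + 1) / N) - ((b : ℝ) / a) ^ ((i : ℝ) / N) ≤ (n : ℝ) ^ 2 / N := by
  have hN : (1 : ℝ) ≤ N := by exact_mod_cast i.zero_le.trans_lt hi
  have ha' : (1 : ℝ) ≤ a := by exact_mod_cast ha
  have one_le_ratio : 1 ≤ (b : ℝ) / a := (one_le_div (by linarith)).2 (by exact_mod_cast hab.le)
  have ratio_le : (b : ℝ) / a ≤ n :=
    (div_le_self b.cast_nonneg ha').trans (by exact_mod_cast hb)
  rw [add_div]
  calc ((b : ℝ) / a) ^ ((i : ℝ) / N + 1 / N) - ((b : ℝ) / a) ^ ((i : ℝ) / N)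
      ≤ (b : ℝ) / a * (1 / N * ((b : ℝ) / a - 1)) :=
        rpow_add_sub_rpow_le one_le_ratio
          (div_le_one_of_le₀ (by exact_mod_cast hi.le) (by linarith)) (by positivity)
          ((div_le_one (by linarith)).2 hN)
    _ ≤ n * (1 / N * n) := by gcongr; linarith
    _ = (n : ℝ) ^ 2 / N := by ring

theorem measureReal_crossing_le {n : ℕ} {σ : ℝ} (hσ : 0 < σ) {μ : Fin n → Measure ℝ}
    [∀ v, IsProbabilityMeasure (μ v)] (hμ : ∀ v, IsSmooth σ (μ v)) {N i : ℕ} (hi : i < N) :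
    (Measure.pi μ).real (crossing n N i) ≤ (n : ℝ) ^ 6 / (N * σ) := by
  have pair_le {u v : Fin n} (huv : u ≠ v) {a b : ℕ} (ha : a ∈ Finset.Icc 1 n)
      (hb : b ∈ Finset.Icc 1 n) (hab : a < b) :
      (Measure.pi μ).real {w | w v ∈ Icc (w u * ((b : ℝ) / a) ^ ((i : ℝ) / N))
        (w u * ((b : ℝ) / a) ^ (((i : ℝ) + 1) / N))} ≤ (n : ℝ) ^ 2 / N / σ := by
    have ha' := (Finset.mem_Icc.1 ha).1
    refine (IsSmooth.measureReal_pi_mem_Icc_mul_le hσ hμ huv ?_).trans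
      (div_le_div_of_nonneg_right (rpow_ratio_sub_le hi ha' hab (Finset.mem_Icc.1 hb).2) hσ.le)
    refine Real.rpow_le_rpow_of_exponent_le ((one_le_div (by exact_mod_cast ha')).2
      (by exact_mod_cast hab.le)) ?_
    gcongr
    linarith
  calc (Measure.pi μ).real (crossing n N i)
      ≤ ∑ _u : Fin n, ∑ _v : Fin n, ∑ _a ∈ Finset.Icc 1 n, ∑ _b ∈ Finset.Icc 1 n,
          (n : ℝ) ^ 2 / N / σ := by
        refine (measureReal_iUnion_fintype_le _).trans (Finset.sum_le_sum fun u _ => ?_)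
        refine (measureReal_iUnion_fintype_le _).trans (Finset.sum_le_sum fun v _ => ?_)
        by_cases huv : u = v
        · simp only [huv, ne_eq, not_true_eq_false, iUnion_false, measureReal_empty]
          positivity
        simp only [ne_eq, huv, not_false_eq_true, iUnion_true]
        refine (measureReal_biUnion_finset_le _ _).trans (Finset.sum_le_sum fun a ha => ?_)
        refine (measureReal_biUnion_finset_le _ _).trans (Finset.sum_le_sum fun b hb => ?_)
        by_cases hab : a < b
        · simpa only [hab, iUnion_true] using pair_le huv ha hb hab
        · simp only [hab, iUnion_false, measureReal_empty]
          positivity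
    _ = (n : ℝ) ^ 6 / (N * σ) := by
        simp only [Finset.sum_const, Finset.card_univ, Fintype.card_fin, Nat.card_Icc,
          Nat.add_sub_cancel, nsmul_eq_mul]
        ring

end MWISInstance

theorem integral_eval_infinitePi {ι : Type*} {E : ι → Type*} [∀ t, MeasurableSpace (E t)]
    (μ : ∀ t, Measure (E t)) [∀ t, IsProbabilityMeasure (μ t)] (t : ι) {f : E t → ℝ}
    (hf : Measurable f) : ∫ w, f (w t) ∂Measure.infinitePi μ = ∫ x, f x ∂μ t := by
  rw [← (measurePreserving_eval_infinitePi μ t).map_eq,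
    integral_map (measurable_pi_apply t).aemeasurable hf.aestronglyMeasurable]

/-- The number of `t < T` with `w t ∈ A`. -/
def hits {E : Type*} (A : Set E) (T : ℕ) (w : ℕ → E) : ℝ :=
  ∑ t ∈ Finset.range T, A.indicator 1 (w t)

section Hits

variable {E : Type*} [MeasurableSpace E] {A : Set E} (μ : ℕ → Measure E)
  [∀ t, IsProbabilityMeasure (μ t)] {p : ℝ}

theorem memLp_indicator_eval (hA : MeasurableSet A) (t : ℕ) :
    MemLp (fun w : ℕ → E => A.indicator (1 : E → ℝ) (w t)) 2 (Measure.infinitePi μ) := by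
  refine MemLp.of_bound ((measurable_one.indicator hA).comp
    (measurable_pi_apply t)).aestronglyMeasurable 1 (ae_of_all _ fun w => ?_)
  by_cases ht : w t ∈ A <;> simp [ht]

theorem memLp_hits (hA : MeasurableSet A) (T : ℕ) :
    MemLp (hits A T) 2 (Measure.infinitePi μ) :=
  memLp_finsetSum _ fun t _ => memLp_indicator_eval μ hA t

theorem integral_indicator_eval (hA : MeasurableSet A) (t : ℕ) :
    ∫ w : ℕ → E, A.indicator (1 : E → ℝ) (w t) ∂Measure.infinitePi μ = (μ t).real A := by
  rw [integral_eval_infinitePi μ t (measurable_one.indicator hA), integral_indicator_one hA]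

theorem integral_hits_le (hA : MeasurableSet A) (hp : ∀ t, (μ t).real A ≤ p) (T : ℕ) :
    ∫ w, hits A T w ∂Measure.infinitePi μ ≤ T * p := by
  calc ∫ w, hits A T w ∂Measure.infinitePi μ = ∑ t ∈ Finset.range T, (μ t).real A := by
        simp only [hits, ← integral_indicator_eval μ hA]
        exact integral_finsetSum _ fun t _ =>
          (memLp_indicator_eval μ hA t).integrable one_le_two
    _ ≤ ∑ _t ∈ Finset.range T, p := Finset.sum_le_sum fun t _ => hp t
    _ = T * p := by rw [Finset.sum_const, Finset.card_range, nsmul_eq_mul]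

theorem variance_hits_le (hA : MeasurableSet A) (hp : ∀ t, (μ t).real A ≤ p) (T : ℕ) :
    Var[hits A T; Measure.infinitePi μ] ≤ T * p := by
  let X (t : ℕ) (w : ℕ → E) : ℝ := A.indicator 1 (w t)
  have indep : iIndepFun X (Measure.infinitePi μ) :=
    iIndepFun_infinitePi (P := μ) (X := fun _ => A.indicator 1) fun _ =>
      measurable_one.indicator hA
  have variance_le (t : ℕ) : Var[X t; Measure.infinitePi μ] ≤ p := by
    have X_sq : X t ^ 2 = X t := by
      ext w
      by_cases ht : w t ∈ A <;> simp [X, ht]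
    refine (variance_le_expectation_sq (memLp_indicator_eval μ hA t).1).trans ?_
    rw [X_sq]
    exact (integral_indicator_eval μ hA t).trans_le (hp t)
  have hits_eq : hits A T = ∑ t ∈ Finset.range T, X t := by
    ext w
    rw [hits, Finset.sum_apply]
  calc Var[hits A T; Measure.infinitePi μ]
      = ∑ t ∈ Finset.range T, Var[X t; Measure.infinitePi μ] := by
        rw [hits_eq]
        exact IndepFun.variance_sum (fun t _ => memLp_indicator_eval μ hA t)
          fun t _ s _ hts => indep.indepFun hts
    _ ≤ ∑ _t ∈ Finset.range T, p := Finset.sum_le_sum fun t _ => variance_le t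
    _ = T * p := by rw [Finset.sum_const, Finset.card_range, nsmul_eq_mul]

end Hits

section SqDeviation

variable {Ω ι : Type*} [MeasurableSpace Ω] {P : Measure Ω} {s : Finset ι} {X : ι → Ω → ℝ}

/-- The sum of the squared deviations of the random variables `X i`, `i ∈ s`, from their means:
a single random variable that controls all deviations at once. -/
def sqDeviation (s : Finset ι) (X : ι → Ω → ℝ) (P : Measure Ω) (ω : Ω) : ℝ :=
  ∑ i ∈ s, (X i ω - ∫ ω', X i ω' ∂P) ^ 2

theorem le_integral_add_sqDeviation {c : ℝ} (hc : 0 < c) {i : ι} (hi : i ∈ s) (ω : Ω) :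
    X i ω ≤ ∫ ω', X i ω' ∂P + c + sqDeviation s X P ω / (4 * c) := by
  set a := X i ω - ∫ ω', X i ω' ∂P
  have sq_le : a ^ 2 ≤ sqDeviation s X P ω :=
    Finset.single_le_sum (f := fun i => (X i ω - ∫ ω', X i ω' ∂P) ^ 2)
      (fun _ _ => sq_nonneg _) hi
  have amgm : a ≤ c + a ^ 2 / (4 * c) := by
    rw [← sub_nonneg]
    calc 0 ≤ (a - 2 * c) ^ 2 / (4 * c) := by positivity
      _ = c + a ^ 2 / (4 * c) - a := by field_simp; ring
  have : a ^ 2 / (4 * c) ≤ sqDeviation s X P ω / (4 * c) := by gcongr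
  linarith

theorem integrable_sqDeviation [IsFiniteMeasure P] (hX : ∀ i ∈ s, MemLp (X i) 2 P) :
    Integrable (sqDeviation s X P) P :=
  integrable_finsetSum _ fun i hi => ((hX i hi).sub (memLp_const _)).integrable_sq

theorem integral_sqDeviation [IsFiniteMeasure P] (hX : ∀ i ∈ s, MemLp (X i) 2 P) :
    ∫ ω, sqDeviation s X P ω ∂P = ∑ i ∈ s, Var[X i; P] := by
  refine (integral_finsetSum _ fun i hi =>
    ((hX i hi).sub (memLp_const _)).integrable_sq).trans ?_
  exact Finset.sum_congr rfl fun i hi => (variance_eq_integral (hX i hi).aemeasurable).symm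

end SqDeviation

theorem exists_lt_mem_Icc_div {N : ℕ} (hN : 0 < N) {r : ℝ} (hr : r ∈ Icc (0 : ℝ) 1) :
    ∃ i < N, r ∈ Icc ((i : ℝ) / N) (((i : ℝ) + 1) / N) := by
  have hN' : (0 : ℝ) < N := by exact_mod_cast hN
  obtain hr1 | rfl := hr.2.lt_or_eq
  · have hrN : 0 ≤ r * N := mul_nonneg hr.1 hN'.le
    exact ⟨⌊r * N⌋₊, (Nat.floor_lt hrN).2 (mul_lt_of_lt_one_left hN' hr1),
      (div_le_iff₀ hN').2 (Nat.floor_le hrN), (le_div_iff₀ hN').2 (Nat.lt_floor_add_one _).le⟩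
  · refine ⟨N - 1, by omega, ?_⟩
    rw [Nat.cast_pred hN, sub_add_cancel, div_self hN'.ne']
    exact ⟨div_le_one_of_le₀ (by linarith) hN'.le, le_rfl⟩

theorem MWISInstance.exists_sum_cost_le {n : ℕ} {V : GreedyVariant} (G : ℕ → SimpleGraph (Fin n))
    {w : ℕ → Fin n → ℝ} (hw : ∀ t v, w t v ∈ Icc (0 : ℝ) 1) {N : ℕ} (hN : 0 < N) (T : ℕ) {r : ℝ}
    (hr : r ∈ Icc (0 : ℝ) 1) :
    ∃ i < N, ∑ t ∈ Finset.range T, (instances G w t).cost V r ≤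
      ∑ t ∈ Finset.range T, (instances G w t).cost V ((i : ℝ) / N) +
        n * hits (crossing n N i) T w := by
  obtain ⟨i, hi, hri⟩ := exists_lt_mem_Icc_div hN hr
  refine ⟨i, hi, ?_⟩
  rw [hits, Finset.mul_sum, ← Finset.sum_add_distrib]
  refine Finset.sum_le_sum fun t _ => ?_
  have cost_mem (ρ : ℝ) := cost_mem_Icc (V := V) (x := instances G w t) (hw t) ρ
  by_cases ht : w t ∈ crossing n N i
  · rw [indicator_of_mem ht, Pi.one_apply, mul_one]
    linarith [(cost_mem r).2, (cost_mem (i / N)).1]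
  · rw [indicator_of_notMem ht, mul_zero, add_zero]
    exact (sameOrder_of_notMem_crossing (fun v => (hw t v).1) ht hri).cost_eq.le

/-- The law of the weights under `smoothLaw Δ`. -/
abbrev weightLaw {n : ℕ} (Δ : ℕ → Fin n → ProbabilityMeasure ℝ) : Measure (ℕ → Fin n → ℝ) :=
  Measure.infinitePi fun t => Measure.pi fun v => (Δ t v : Measure ℝ)

/-- The law of the draws of the learner under `smoothLaw Δ`. -/
abbrev drawLaw : Measure (ℕ → unitInterval) :=
  Measure.infinitePi fun _ => volume

namespace MWISInstance

variable {n : ℕ} {V : GreedyVariant}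

theorem ae_weights_mem_Icc {σ : ℝ} {Δ : ℕ → Fin n → ProbabilityMeasure ℝ}
    (hΔ : ∀ t v, IsSmooth σ (Δ t v : Measure ℝ)) :
    ∀ᵐ w ∂weightLaw Δ, ∀ t v, w t v ∈ Icc (0 : ℝ) 1 := by
  refine ae_all_iff.2 fun t => ae_all_iff.2 fun v => ?_
  have round_mem : ∀ᵐ y ∂Measure.pi fun v => (Δ t v : Measure ℝ), y v ∈ Icc (0 : ℝ) 1 :=
    (measurePreserving_eval (fun v => (Δ t v : Measure ℝ)) v).quasiMeasurePreserving.ae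
      (hΔ t v).ae_mem_Icc
  exact (measurePreserving_eval_infinitePi
    (fun t => Measure.pi fun v => (Δ t v : Measure ℝ)) t).quasiMeasurePreserving.ae round_mem

theorem sum_cost_mem_Icc {x : ℕ → MWISInstance n} (hx : ∀ t v, (x t).weight v ∈ Icc (0 : ℝ) 1)
    (ρ : ℕ → ℝ) (T : ℕ) : ∑ t ∈ Finset.range T, (x t).cost V (ρ t) ∈ Icc (0 : ℝ) (T * n) := by
  refine ⟨Finset.sum_nonneg fun t _ => (cost_mem_Icc (hx t) _).1, ?_⟩
  refine (Finset.sum_le_sum fun t _ => (cost_mem_Icc (hx t) _).2).trans_eq ?_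
  rw [Finset.sum_const, Finset.card_range, nsmul_eq_mul]

theorem abs_regret_le {x : ℕ → MWISInstance n} (hx : ∀ t v, (x t).weight v ∈ Icc (0 : ℝ) 1)
    (ρ : ℕ → ℝ) (T : ℕ) : |regret V x ρ T| ≤ n := by
  set S := ⨆ r : Icc (0 : ℝ) 1, ∑ t ∈ Finset.range T, (x t).cost V r
  have hS0 : 0 ≤ S := Real.iSup_nonneg fun r => (sum_cost_mem_Icc hx (fun _ => r) T).1
  have hS1 : S ≤ T * n := ciSup_le fun r => (sum_cost_mem_Icc hx (fun _ => r) T).2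
  have hρ := sum_cost_mem_Icc (V := V) hx ρ T
  rw [regret, abs_mul, abs_of_nonneg (by positivity), one_div]
  refine inv_mul_le_of_le_mul₀ T.cast_nonneg n.cast_nonneg (abs_le.2 ?_)
  constructor <;> linarith [hρ.1, hρ.2]

/-- The squared deviation, summed over all cells of the grid `i / N`, of the number of rounds in
which the weights lie in `crossing n N i`. -/
def crossingDeviation (Δ : ℕ → Fin n → ProbabilityMeasure ℝ) (N T : ℕ) :
    (ℕ → Fin n → ℝ) → ℝ :=
  sqDeviation (Finset.range N) (fun i => hits (crossing n N i) T) (weightLaw Δ)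

theorem integrable_crossingDeviation (Δ : ℕ → Fin n → ProbabilityMeasure ℝ) (N T : ℕ) :
    Integrable (crossingDeviation Δ N T) (weightLaw Δ) :=
  integrable_sqDeviation fun i _ => memLp_hits _ (measurableSet_crossing n N i) T

theorem integral_crossingDeviation_le {σ : ℝ} (hσ : 0 < σ)
    {Δ : ℕ → Fin n → ProbabilityMeasure ℝ} (hΔ : ∀ t v, IsSmooth σ (Δ t v : Measure ℝ))
    (N T : ℕ) : ∫ w, crossingDeviation Δ N T w ∂weightLaw Δ ≤ T * ((n : ℝ) ^ 6 / σ) := by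
  calc ∫ w, crossingDeviation Δ N T w ∂weightLaw Δ
      = ∑ i ∈ Finset.range N, Var[hits (crossing n N i) T; weightLaw Δ] :=
        integral_sqDeviation fun i _ => memLp_hits _ (measurableSet_crossing n N i) T
    _ ≤ ∑ _i ∈ Finset.range N, (T : ℝ) * ((n : ℝ) ^ 6 / (N * σ)) :=
        Finset.sum_le_sum fun i hi => variance_hits_le _ (measurableSet_crossing n N i)
          (fun t => measureReal_crossing_le hσ (hΔ t) (Finset.mem_range.1 hi)) T
    _ = N * (T * ((n : ℝ) ^ 6 / (N * σ))) := by
        rw [Finset.sum_const, Finset.card_range, nsmul_eq_mul]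
    _ ≤ T * ((n : ℝ) ^ 6 / σ) := by
        obtain rfl | hN := eq_or_ne N 0
        · rw [Nat.cast_zero, zero_mul]
          positivity
        · exact le_of_eq (by field_simp)

theorem iSup_cost_le {σ : ℝ} (hσ : 0 < σ) {Δ : ℕ → Fin n → ProbabilityMeasure ℝ}
    (hΔ : ∀ t v, IsSmooth σ (Δ t v : Measure ℝ)) (G : ℕ → SimpleGraph (Fin n))
    {w : ℕ → Fin n → ℝ} (hw : ∀ t v, w t v ∈ Icc (0 : ℝ) 1) {N : ℕ} (hN : 0 < N) (T : ℕ)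
    {B c : ℝ} (hc : 0 < c)
    (hB : ∀ i < N, ∑ t ∈ Finset.range T, (instances G w t).cost V ((i : ℝ) / N) ≤ B) :
    ⨆ r : Icc (0 : ℝ) 1, ∑ t ∈ Finset.range T, (instances G w t).cost V r ≤
      B + n * (T * ((n : ℝ) ^ 6 / (N * σ)) + c + crossingDeviation Δ N T w / (4 * c)) := by
  refine ciSup_le fun r => ?_
  obtain ⟨i, hi, hri⟩ := exists_sum_cost_le (V := V) G hw hN T r.2
  refine hri.trans (add_le_add (hB i hi) (mul_le_mul_of_nonneg_left ?_ n.cast_nonneg))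
  refine (le_integral_add_sqDeviation (X := fun i => hits (crossing n N i) T)
    (P := weightLaw Δ) hc (Finset.mem_range.2 hi) w).trans ?_
  gcongr
  · exact integral_hits_le _ (measurableSet_crossing n N i)
      (fun t => measureReal_crossing_le hσ (hΔ t) hi) T
  · exact le_rfl

end MWISInstance

namespace Learner

open MWISInstance

variable {n p q : ℕ} {σ : ℝ} {V : GreedyVariant}

/-- The expected total cost of `hedge V p q` over its own draws. -/
def meanCost (V : GreedyVariant) (σ : ℝ) (p q : ℕ) (x : ℕ → MWISInstance n) (T : ℕ) : ℝ :=
  ∑ t ∈ Finset.range T, (Finset.range (gridSize n σ p)).centerMass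
    (expertWeight V σ q (gridSize n σ p) x t) fun i => (x t).cost V ((i : ℝ) / gridSize n σ p)

theorem measurable_cost_expert (x : ℕ → MWISInstance n) (t : ℕ) :
    Measurable fun u => (x t).cost V ((expert V σ p q x t u : ℝ) / gridSize n σ p) :=
  (measurable_from_top (f := fun k : ℕ => (x t).cost V ((k : ℝ) / gridSize n σ p))).comp
    (measurable_pick (W := fun _ => expertWeight V σ q (gridSize n σ p) x t)
      (fun _ => measurable_const) (measurable_subtype_coe.mul_const _) _)

section FixedInstances

variable {x : ℕ → MWISInstance n} (hx : ∀ t v, (x t).weight v ∈ Icc (0 : ℝ) 1)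
include hx

theorem gain_mem_Icc (N t i : ℕ) : gain V N x t i ∈ Icc (0 : ℝ) 1 :=
  have h := cost_mem_Icc (V := V) (hx t) ((i : ℝ) / N)
  ⟨div_nonneg h.1 n.cast_nonneg, div_le_one_of_le₀ h.2 n.cast_nonneg⟩

theorem sum_cost_grid_le (hn : 1 ≤ n) (hσ : 0 < σ) (T : ℕ) {i : ℕ} (hi : i < gridSize n σ p) :
    ∑ t ∈ Finset.range T, (x t).cost V ((i : ℝ) / gridSize n σ p) ≤ meanCost V σ p q x T +
      n * (1 / ((n : ℝ) + 1 / σ) ^ q * T + gridSize n σ p * ((n : ℝ) + 1 / σ) ^ q) := by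
  set N := gridSize n σ p with hN
  set y := (n : ℝ) + 1 / σ
  have hn0 : (n : ℝ) ≠ 0 := by positivity
  have cost_eq (t i : ℕ) : (x t).cost V ((i : ℝ) / N) = n * gain V N x t i :=
    (mul_div_cancel₀ _ hn0).symm
  have mean_eq : meanCost V σ p q x T = n * ∑ t ∈ Finset.range T,
      (Finset.range N).centerMass (multiplicativeWeight (1 / y ^ q) (gain V N x) t)
        (gain V N x t) := by
    rw [meanCost, Finset.mul_sum]
    simp only [← hN, cost_eq, ← smul_eq_mul (n : ℝ), Finset.centerMass_smul]
    rfl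
  have log_le : Real.log (Finset.range N).card / (1 / y ^ q) ≤ N * y ^ q := by
    rw [Finset.card_range, div_div_eq_mul_div, div_one]
    exact mul_le_mul_of_nonneg_right (Real.log_le_self N.cast_nonneg) (by positivity)
  have hedge_le := multiplicativeWeight_regret_le (s := Finset.range N) (g := gain V N x)
    (ε := 1 / y ^ q) (by positivity) (fun t j _ => gain_mem_Icc hx N t j) T (Finset.mem_range.2 hi)
  simp only [cost_eq]
  rw [mean_eq, ← Finset.mul_sum, ← mul_add]
  exact mul_le_mul_of_nonneg_left (by linarith) n.cast_nonneg

theorem integrable_cost_expert (t : ℕ) :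
    Integrable (fun U : ℕ → unitInterval =>
      (x t).cost V ((expert V σ p q x t (U t) : ℝ) / gridSize n σ p)) drawLaw := by
  refine Integrable.of_bound ((measurable_cost_expert x t).comp
    (measurable_pi_apply t)).aestronglyMeasurable n (ae_of_all _ fun U => ?_)
  have cost_mem := cost_mem_Icc (V := V) (hx t) ((expert V σ p q x t (U t) : ℝ) / gridSize n σ p)
  exact (Real.norm_of_nonneg cost_mem.1).trans_le cost_mem.2

theorem integral_cost_expert (hn : 1 ≤ n) (hσ : 0 < σ) (t : ℕ) :
    ∫ U, (x t).cost V ((expert V σ p q x t (U t) : ℝ) / gridSize n σ p) ∂drawLaw =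
      (Finset.range (gridSize n σ p)).centerMass (expertWeight V σ q (gridSize n σ p) x t)
        fun i => (x t).cost V ((i : ℝ) / gridSize n σ p) := by
  have hε : 0 ≤ 1 / ((n : ℝ) + 1 / σ) ^ q := by positivity
  have gain_nonneg (t i : ℕ) : 0 ≤ gain V (gridSize n σ p) x t i := (gain_mem_Icc hx _ t i).1
  have sum_pos : 0 < ∑ i ∈ Finset.range (gridSize n σ p),
      expertWeight V σ q (gridSize n σ p) x t i :=
    sum_multiplicativeWeight_pos (Finset.nonempty_range_iff.2 (gridSize_pos hn hσ).ne') hε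
      (fun t i _ => gain_nonneg t i) t
  have eval_eq := integral_eval_infinitePi (fun _ : ℕ => (volume : Measure unitInterval)) t
    (measurable_cost_expert (V := V) (σ := σ) (p := p) (q := q) x t)
  refine eval_eq.trans ?_
  exact integral_pick (fun i => (multiplicativeWeight_pos hε (gain_nonneg · i) t).le) sum_pos
    fun i => (x t).cost V ((i : ℝ) / gridSize n σ p)

theorem integral_regret_draws (hn : 1 ≤ n) (hσ : 0 < σ) (T : ℕ) :
    ∫ U, regret V x ((hedge V p q).action σ U x) T ∂drawLaw =
      (1 / (T : ℝ)) * ((⨆ r : Icc (0 : ℝ) 1, ∑ t ∈ Finset.range T, (x t).cost V r) -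
        meanCost V σ p q x T) := by
  simp only [regret, hedge_action fun t v => (hx t v).1]
  rw [integral_const_mul, integral_sub (integrable_const _)
    (integrable_finsetSum _ fun t _ => integrable_cost_expert hx t), integral_const, probReal_univ,
    one_smul, integral_finsetSum _ fun t _ => integrable_cost_expert hx t]
  simp only [integral_cost_expert hx hn hσ]
  rfl

end FixedInstances

theorem measurable_expertWeight (G : ℕ → SimpleGraph (Fin n)) (N t i : ℕ) :
    Measurable fun w : ℕ → Fin n → ℝ => expertWeight V σ q N (instances G w) t i :=
  measurable_multiplicativeWeight (fun s => ((measurable_cost (G s)).comp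
    (measurable_const.prodMk (measurable_pi_apply s))).div_const _) t

theorem measurable_expert_instances (G : ℕ → SimpleGraph (Fin n)) (t : ℕ) :
    Measurable fun z : (ℕ → Fin n → ℝ) × (ℕ → unitInterval) =>
      expert V σ p q (instances G z.1) t (z.2 t) := by
  have measurable_weight (i : ℕ) : Measurable fun z : (ℕ → Fin n → ℝ) × (ℕ → unitInterval) =>
      expertWeight V σ q (gridSize n σ p) (instances G z.1) t i :=
    (measurable_expertWeight G _ t i).comp measurable_fst
  exact measurable_pick measurable_weight ((measurable_subtype_coe.comp
    ((measurable_pi_apply t).comp measurable_snd)).mul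
      (Finset.measurable_sum _ fun i _ => measurable_weight i)) _

theorem measurable_regret_expert (G : ℕ → SimpleGraph (Fin n)) (T : ℕ) :
    Measurable fun z : (ℕ → Fin n → ℝ) × (ℕ → unitInterval) => regret V (instances G z.1)
      (fun t => (expert V σ p q (instances G z.1) t (z.2 t) : ℝ) / gridSize n σ p) T := by
  refine (((measurable_iSup_cost G T).comp measurable_fst).sub
    (Finset.measurable_sum _ fun t _ => ?_)).const_mul _
  exact (measurable_cost (G t)).comp
    (((measurable_from_top (f := fun k : ℕ => (k : ℝ))).comp
      (measurable_expert_instances G t)).div_const _ |>.prodMk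
        ((measurable_pi_apply t).comp measurable_fst))

theorem integrable_regret (G : ℕ → SimpleGraph (Fin n)) {Δ : ℕ → Fin n → ProbabilityMeasure ℝ}
    (hΔ : ∀ t v, IsSmooth σ (Δ t v : Measure ℝ)) (T : ℕ) :
    Integrable (fun z : (ℕ → Fin n → ℝ) × (ℕ → unitInterval) =>
      regret V (instances G z.1) ((hedge V p q).action σ z.2 (instances G z.1)) T)
      (smoothLaw Δ) := by
  have : IsProbabilityMeasure (smoothLaw Δ) :=
    inferInstanceAs (IsProbabilityMeasure ((weightLaw Δ).prod drawLaw))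
  have weights_mem : ∀ᵐ z ∂smoothLaw Δ, ∀ t v, z.1 t v ∈ Icc (0 : ℝ) 1 :=
    Measure.quasiMeasurePreserving_fst.ae (ae_weights_mem_Icc hΔ)
  refine Integrable.of_bound ⟨_, (measurable_regret_expert (V := V) (σ := σ) (p := p) (q := q) G
    T).stronglyMeasurable, ?_⟩ n ?_
  · filter_upwards [weights_mem] with z hz
    have action_eq := hedge_action (V := V) (σ := σ) (p := p) (q := q) (U := z.2)
      (x := instances G z.1) fun t v => (hz t v).1
    simp only [regret, action_eq]
  · filter_upwards [weights_mem] with z hz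
    exact abs_regret_le hz _ T

theorem integral_regret_draws_le (hn : 1 ≤ n) (hσ : 0 < σ) (G : ℕ → SimpleGraph (Fin n))
    {Δ : ℕ → Fin n → ProbabilityMeasure ℝ} (hΔ : ∀ t v, IsSmooth σ (Δ t v : Measure ℝ))
    {w : ℕ → Fin n → ℝ} (hw : ∀ t v, w t v ∈ Icc (0 : ℝ) 1) {T : ℕ} (hT : 0 < T) {δ : ℝ}
    (hδ : 0 < δ) :
    ∫ U, regret V (instances G w) ((hedge V p q).action σ U (instances G w)) T ∂drawLaw ≤
      n * (1 / ((n : ℝ) + 1 / σ) ^ q + gridSize n σ p * ((n : ℝ) + 1 / σ) ^ q / T +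
        (n : ℝ) ^ 6 / σ / gridSize n σ p + δ) +
      n / (4 * δ * T ^ 2) * crossingDeviation Δ (gridSize n σ p) T w := by
  have hT' : (0 : ℝ) < T := by exact_mod_cast hT
  have iSup_le := iSup_cost_le (V := V) hσ hΔ G hw (gridSize_pos hn hσ) T (mul_pos hδ hT')
    fun i hi => sum_cost_grid_le (V := V) (p := p) (q := q) (x := instances G w) hw hn hσ T hi
  have hN : (0 : ℝ) < gridSize n σ p := by exact_mod_cast gridSize_pos hn hσ
  rw [integral_regret_draws (x := instances G w) hw hn hσ, one_div_mul_eq_div, div_le_iff₀ hT',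
    sub_le_iff_le_add']
  refine iSup_le.trans_eq ?_
  field_simp
  ring

theorem integral_regret_le (hn : 1 ≤ n) (hσ : 0 < σ) (G : ℕ → SimpleGraph (Fin n))
    {Δ : ℕ → Fin n → ProbabilityMeasure ℝ} (hΔ : ∀ t v, IsSmooth σ (Δ t v : Measure ℝ)) {T : ℕ}
    (hT : 0 < T) {δ : ℝ} (hδ : 0 < δ) :
    ∫ z, regret V (instances G z.1) ((hedge V p q).action σ z.2 (instances G z.1)) T
      ∂smoothLaw Δ ≤
    n * (1 / ((n : ℝ) + 1 / σ) ^ q + gridSize n σ p * ((n : ℝ) + 1 / σ) ^ q / T +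
      (n : ℝ) ^ 6 / σ / gridSize n σ p + δ + (n : ℝ) ^ 6 / σ / (4 * δ * T)) := by
  have : (0 : ℝ) < T := by exact_mod_cast hT
  set a : ℝ := n * (1 / ((n : ℝ) + 1 / σ) ^ q + gridSize n σ p * ((n : ℝ) + 1 / σ) ^ q / T +
    (n : ℝ) ^ 6 / σ / gridSize n σ p + δ) with ha
  have integrable_deviation :=
    (integrable_crossingDeviation Δ (gridSize n σ p) T).const_mul ((n : ℝ) / (4 * δ * T ^ 2))
  have integrable := integrable_regret (V := V) (p := p) (q := q) G hΔ T
  calc ∫ z, regret V (instances G z.1) ((hedge V p q).action σ z.2 (instances G z.1)) T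
        ∂smoothLaw Δ
      = ∫ w, ∫ U, regret V (instances G w) ((hedge V p q).action σ U (instances G w)) T
          ∂drawLaw ∂weightLaw Δ := integral_prod _ integrable
    _ ≤ ∫ w, a + n / (4 * δ * T ^ 2) * crossingDeviation Δ (gridSize n σ p) T w ∂weightLaw Δ := by
        refine integral_mono_ae integrable.integral_prod_left
          ((integrable_const a).add integrable_deviation) ?_
        filter_upwards [ae_weights_mem_Icc hΔ] with w hw
        exact integral_regret_draws_le hn hσ G hΔ hw hT hδ
    _ = a + n / (4 * δ * T ^ 2) *
          ∫ w, crossingDeviation Δ (gridSize n σ p) T w ∂weightLaw Δ := by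
        rw [integral_add (integrable_const a) integrable_deviation, integral_const, probReal_univ,
          one_smul, integral_const_mul]
    _ ≤ a + n / (4 * δ * T ^ 2) * (T * ((n : ℝ) ^ 6 / σ)) := by
        gcongr
        exact integral_crossingDeviation_le hσ hΔ _ T
    _ = _ := by
        rw [ha]
        field_simp

theorem one_div_pow_add_three_le {y : ℝ} (hy : 2 ≤ y) (d : ℕ) :
    1 / y ^ (d + 3) ≤ 1 / y ^ d / 8 := by
  have hy3 : 8 ≤ y ^ 3 := by
    calc (8 : ℝ) = 2 ^ 3 := by norm_num
      _ ≤ y ^ 3 := by gcongr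
  rw [div_div, pow_add]
  gcongr

theorem tuned_parameters_le {y N T s : ℝ} {d : ℕ} (hy : 2 ≤ y) (hN : y ^ (d + 12) ≤ N)
    (hN' : N ≤ 2 * y ^ (d + 12)) (hT : y ^ (3 * d + 21) ≤ T) (hs : s ≤ y ^ 7) :
    y * (1 / y ^ (d + 4) + N * y ^ (d + 4) / T + s / N + 1 / y ^ (d + 4) +
      s / (4 * (1 / y ^ (d + 4)) * T)) ≤ 1 / y ^ d := by
  have hy1 : 1 ≤ y := by linarith
  have : 0 < N := lt_of_lt_of_le (by positivity) hN
  have : 0 < T := lt_of_lt_of_le (by positivity) hT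
  have learning_rate : y * (1 / y ^ (d + 4)) = 1 / y ^ (d + 3) := by
    field_simp
    ring
  have experts : y * (N * y ^ (d + 4) / T) ≤ 1 / y ^ (d + 3) := by
    calc y * (N * y ^ (d + 4) / T)
        ≤ y * (y * y ^ (d + 12) * y ^ (d + 4) / y ^ (3 * d + 21)) := by
          gcongr
          exact hN'.trans (by gcongr)
      _ = 1 / y ^ (d + 3) := by field_simp; ring
  have crossing : y * (s / N) ≤ 1 / y ^ (d + 3) := by
    calc y * (s / N) ≤ y * (y ^ 7 / y ^ (d + 12)) := by gcongr
      _ = 1 / y ^ (d + 4) := by field_simp; ring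
      _ ≤ 1 / y ^ (d + 3) := by gcongr; omega
  have deviation : y * (s / (4 * (1 / y ^ (d + 4)) * T)) ≤ 1 / y ^ (d + 3) := by
    calc y * (s / (4 * (1 / y ^ (d + 4)) * T))
        ≤ y * (y ^ 7 / (1 * (1 / y ^ (d + 4)) * y ^ (3 * d + 21))) := by gcongr; norm_num
      _ = 1 / y ^ (2 * d + 9) := by field_simp; ring
      _ ≤ 1 / y ^ (d + 3) := by gcongr <;> omega
  have hd : 0 < 1 / y ^ d := by positivity
  linarith [one_div_pow_add_three_le hy d]

theorem integral_regret_tuned_le (d : ℕ) (hn : 1 ≤ n) (hσ : 0 < σ) (hσ1 : σ < 1)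
    (G : ℕ → SimpleGraph (Fin n)) {Δ : ℕ → Fin n → ProbabilityMeasure ℝ}
    (hΔ : ∀ t v, IsSmooth σ (Δ t v : Measure ℝ)) {T : ℕ}
    (hT : ((n : ℝ) + 1 / σ) ^ (3 * d + 21) ≤ T) :
    ∫ z, regret V (instances G z.1)
      ((hedge V (d + 12) (d + 4)).action σ z.2 (instances G z.1)) T ∂smoothLaw Δ ≤
        1 / (n : ℝ) ^ d := by
  have hT0 : 0 < T := Nat.cast_pos.1 (lt_of_lt_of_le (by positivity) hT)
  refine (integral_regret_le hn hσ G hΔ hT0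
    (δ := 1 / ((n : ℝ) + 1 / σ) ^ (d + 4)) (by positivity)).trans ?_
  have hN : ((n : ℝ) + 1 / σ) ^ (d + 12) ≤ gridSize n σ (d + 12) := Nat.le_ceil _
  have hy : 2 ≤ (n : ℝ) + 1 / σ := two_le_scale hn hσ hσ1
  have hny : (n : ℝ) ≤ (n : ℝ) + 1 / σ := le_add_of_nonneg_right (by positivity)
  have hσy : 1 / σ ≤ (n : ℝ) + 1 / σ := le_add_of_nonneg_left n.cast_nonneg
  have smoothness_le : (n : ℝ) ^ 6 / σ ≤ ((n : ℝ) + 1 / σ) ^ 7 := by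
    rw [div_eq_mul_one_div, pow_succ _ 6]
    gcongr
  calc _ ≤ _ := mul_le_mul_of_nonneg_right hny (by positivity)
    _ ≤ 1 / ((n : ℝ) + 1 / σ) ^ d :=
      tuned_parameters_le hy hN (gridSize_le hn hσ hσ1) hT smoothness_le
    _ ≤ 1 / (n : ℝ) ^ d := by gcongr

end Learner

end

theorem theorem4p5 (V : GreedyVariant) (d : ℕ) :
    ∃ (L : Learner) (C : ℕ), ∀ (n : ℕ) (σ : ℝ), 1 ≤ n → 0 < σ → σ < 1 →
      -- running time in every round, and legality of the choices
      (∀ (x : ℕ → MWISInstance n) (U : ℕ → unitInterval),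
        (∀ t v, (x t).weight v ∈ Icc (0 : ℝ) 1) →
          ((L.memory σ U x 0).time : ℝ) ≤ C * ((n : ℝ) + 1 / σ) ^ C ∧
          ∀ t, ((L.memory σ U x (t + 1)).time : ℝ) ≤
              (L.memory σ U x t).time + C * ((n : ℝ) + 1 / σ) ^ C ∧
            L.action σ U x t ∈ Icc (0 : ℝ) 1) ∧
      -- expected regret
      (∀ (G : ℕ → SimpleGraph (Fin n)) (Δ : ℕ → Fin n → ProbabilityMeasure ℝ),
        (∀ t v, IsSmooth σ (Δ t v : Measure ℝ)) →
        ∀ T : ℕ, C * ((n : ℝ) + 1 / σ) ^ C ≤ (T : ℝ) →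
          Integrable (fun p : (ℕ → Fin n → ℝ) × (ℕ → unitInterval) =>
            regret V (instances G p.1) (L.action σ p.2 (instances G p.1)) T) (smoothLaw Δ) ∧
          ∫ p, regret V (instances G p.1) (L.action σ p.2 (instances G p.1)) T ∂(smoothLaw Δ) ≤
            1 / (n : ℝ) ^ d) := by
  obtain ⟨K, hK⟩ := Learner.exists_time_hedge_le V (d + 12) (d + 4)
  refine ⟨Learner.hedge V (d + 12) (d + 4), K + (3 * d + 21), fun n σ hn hσ hσ1 => ?_⟩
  have one_le_scale : 1 ≤ (n : ℝ) + 1 / σ := one_le_two.trans (Learner.two_le_scale hn hσ hσ1)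
  have time_le : K * ((n : ℝ) + 1 / σ) ^ K ≤
      (K + (3 * d + 21) : ℕ) * ((n : ℝ) + 1 / σ) ^ (K + (3 * d + 21)) := by
    gcongr <;> omega
  have horizon_le : ((n : ℝ) + 1 / σ) ^ (3 * d + 21) ≤
      (K + (3 * d + 21) : ℕ) * ((n : ℝ) + 1 / σ) ^ (K + (3 * d + 21)) :=
    (pow_le_pow_right₀ one_le_scale (Nat.le_add_left _ _)).trans
      (le_mul_of_one_le_left (by positivity) (by exact_mod_cast (by omega)))
  constructor
  · intro x U _
    obtain ⟨start_le, round_le⟩ := hK n σ x U hn hσ hσ1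
    exact ⟨start_le.trans time_le, fun t =>
      ⟨(round_le t).trans (by gcongr), Learner.hedge_action_mem hn hσ t⟩⟩
  · intro G Δ hΔ T hT
    exact ⟨Learner.integrable_regret G hΔ T,
      Learner.integral_regret_tuned_le d hn hσ hσ1 G hΔ (horizon_le.trans hT)⟩
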